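/- Let $n\ge 1$, let $V\in C^\infty(\mathbb{R}^n,\mathbb{R})$, $E_c\in\mathbb{R}$, $x_0\in\mathbb{R}^n$, and suppose that $$V(x)=E_c+V_{2k}(x-x_0)+\mathcal{O}(|x-x_0|^{2k+1})\qquad (x\to x_0),$$ where $k\ge 2$ is an integer and $V_{2k}:\mathbb{R}^n\to\mathbb{R}$ is homogeneous of degree $2k$ and negative definite ($V_{2k}(v)<0$ for $v\ne 0$). Put $p(x,\xi)=|\xi|^2+V(x)$ and $z_0=(x_0,0)$. Let $T>0$, let $W$ be an open subset of $\mathbb{R}\times\mathbb{R}^n\times\mathbb{R}^n$ containing $[-T,T]\times\{z_0\}$, let $S=S(t,x,\xi)$ be a $C^\infty$ real-valued solution on $W$ of the Hamilton-Jacobi problem $$\partial_tS+p(x,\partial_xS)=0,\qquad S(0,x,\xi)=\langle x,\xi\rangle,$$ and let $\Psi(t,x,\xi)=S(t,x,\xi)-\langle x,\xi\rangle+tE_c$. Then, after the polar blow-up $x=x_0+r\theta$, $\xi=q\eta$ with $r,q\in\mathbb{R}$ and $\theta,\eta\in\mathbb{S}^{n-1}$, there are local coordinates near the exceptional set $\{r=q=0\}$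 in which $\Psi$ has the normal form $-\chi_0(\chi_1^2-\chi_2^{2k})$. Precisely: there are an open subset $U$ of $\mathbb{R}\times\mathbb{R}\times\mathbb{S}^{n-1}\times\mathbb{R}\times\mathbb{S}^{n-1}$, containing all points $(t,0,\theta,0,\eta)$ with $|t|\le T$ and $\theta,\eta\in\mathbb{S}^{n-1}$, such that $(t,x_0+r\theta,q\eta)\in W$ for all $(t,r,\theta,q,\eta)\in U$, and a $C^\infty$ diffeomorphism $$\chi:(t,r,\theta,q,\eta)\mapsto(\chi_0,\chi_1,\chi_2,\theta,\eta),\qquad \chi_0=t,$$ of $U$ onto an open subset of $\mathbb{R}^3\times\mathbb{S}^{n-1}\times\mathbb{S}^{n-1}$, such that on $U$ $$\Psi(t,x_0+r\theta,q\eta)=-\chi_0\left(\chi_1^2-\chi_2^{2k}\right),$$ where moreover $\chi_2$ has the same sign as $r$ (in particular $\chi_2=0$ iff $r=0$) and, at points with $r=0$, $\chi_1$ has the same sign as $q$ (in particular $\chi_1=0$ iff $q=0$). -/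

import Mathlib

open scoped ContDiff Manifold
open Set Filter Topology Asymptotics

namespace DegenerateMaximum

/-- The configuration space `ℝⁿ`, with `n = d + 1 ≥ 1`. -/
abbrev Conf (d : ℕ) : Type := EuclideanSpace ℝ (Fin (d + 1))

/-- The unit sphere `𝕊ⁿ⁻¹` of `ℝⁿ`, `n = d + 1`, with the smooth structure of Mathlib. -/
abbrev UnitSphere (d : ℕ) : Type := Metric.sphere (0 : Conf d) 1

/-- The classical symbol `p(x, ξ) = |ξ|² + V(x)` of `-h²Δ + V`. -/
noncomputable def symbol {d : ℕ} (V : Conf d → ℝ) (x ξ : Conf d) : ℝ :=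
  ‖ξ‖ ^ 2 + V x

/-- `V` has at `x₀` a totally degenerate local maximum of level `Ec`: near `x₀` it is
`Ec + V2k (x - x₀) + O(|x - x₀| ^ (2k+1))`, where `k ≥ 2` and `V2k` is homogeneous of degree `2k`
and negative definite. -/
structure HasDegenerateMaximum {d : ℕ} (V : Conf d → ℝ) (Ec : ℝ) (x₀ : Conf d)
    (k : ℕ) (V2k : Conf d → ℝ) : Prop where
  two_le : 2 ≤ k
  homogeneous : ∀ (c : ℝ) (v : Conf d), V2k (c • v) = c ^ (2 * k) * V2k v
  negative : ∀ v : Conf d, v ≠ 0 → V2k v < 0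
  expansion : (fun x => V x - (Ec + V2k (x - x₀))) =O[𝓝 x₀] fun x => ‖x - x₀‖ ^ (2 * k + 1)

/-- `S` is a smooth solution, on the open set `W` of points `(t, x, ξ)`, of the Hamilton-Jacobi
problem `∂ₜS + p(x, ∂ₓS) = 0`, `S(0, x, ξ) = ⟨x, ξ⟩`. -/
structure SolvesHamiltonJacobi {d : ℕ} (V : Conf d → ℝ) (W : Set (ℝ × Conf d × Conf d))
    (S : ℝ → Conf d → Conf d → ℝ) : Prop where
  isOpen : IsOpen W
  smooth : ContDiffOn ℝ ∞ (fun w : ℝ × Conf d × Conf d => S w.1 w.2.1 w.2.2) W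
  equation : ∀ (t : ℝ) (x ξ : Conf d), (t, x, ξ) ∈ W →
    deriv (fun s => S s x ξ) t + symbol V x (gradient (fun y => S t y ξ) x) = 0
  initial : ∀ x ξ : Conf d, (0, x, ξ) ∈ W → S 0 x ξ = inner ℝ x ξ

/-- The phase `Ψ(t, x, ξ) = S(t, x, ξ) - ⟨x, ξ⟩ + t Ec`. -/
noncomputable def phase {d : ℕ} (S : ℝ → Conf d → Conf d → ℝ) (Ec : ℝ)
    (t : ℝ) (x ξ : Conf d) : ℝ :=
  S t x ξ - inner ℝ x ξ + t * Ec

/-- The blown-up space, with points `(t, r, θ, q, η)`; the exceptional set over the equilibrium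
`z₀ = (x₀, 0)` is `r = q = 0`. -/
abbrev BlowUp (d : ℕ) : Type := ℝ × ℝ × UnitSphere d × ℝ × UnitSphere d

/-- The space of the new coordinates `(χ₀, χ₁, χ₂, θ, η)`, where the pair of angles `(θ, η)` in
`𝕊ⁿ⁻¹ × 𝕊ⁿ⁻¹` stands for the remaining `2n - 2` coordinates `χ₃, …, χ₂ₙ`. -/
abbrev NormalSpace (d : ℕ) : Type := ℝ × ℝ × ℝ × UnitSphere d × UnitSphere d

/-- The smooth model of `BlowUp d`. -/
noncomputable abbrev blowUpModel (d : ℕ) :=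
  𝓘(ℝ, ℝ).prod (𝓘(ℝ, ℝ).prod ((𝓡 d).prod (𝓘(ℝ, ℝ).prod (𝓡 d))))

/-- The smooth model of `NormalSpace d`. -/
noncomputable abbrev normalModel (d : ℕ) :=
  𝓘(ℝ, ℝ).prod (𝓘(ℝ, ℝ).prod (𝓘(ℝ, ℝ).prod ((𝓡 d).prod (𝓡 d))))

/-- The polar blow-down map `(t, r, θ, q, η) ↦ (t, x, ξ) = (t, x₀ + r θ, q η)`. -/
def blowDown {d : ℕ} (x₀ : Conf d) (u : BlowUp d) : ℝ × Conf d × Conf d :=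
  (u.1, x₀ + u.2.1 • (u.2.2.1 : Conf d), u.2.2.2.1 • (u.2.2.2.2 : Conf d))

end DegenerateMaximum

namespace DegenerateMaximum

-- Put y = x - x₀. The phase solves ∂ₜΨ + |∇_yΨ + ξ|² + V(x₀ + y) - Ec = 0 with Ψ = 0 at t = 0. Give
-- y weight 1 and ξ weight k, so that |ξ|² and `V2k` both have weight 2k. The core of the proof is
-- that Ψ(t, l y, l^k ξ) is l^(2k) times a smooth function of (t, y, ξ, l) whose value at l = 0 is
-- -t(|ξ|² + `V2k` y).
--
-- Vanishing to order 2 in l holds because the origin is an equilibrium: the spatial gradient there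
-- satisfies a linear differential inequality in t and starts from zero
-- (`gradient_eq_zero_of_hamiltonJacobi`). Suppose then that Ψ = l^m g. Dividing the equation by l^m
-- and letting l → 0 leaves a Hamilton-Jacobi equation without potential if m = 2, and ∂ₜg = 0 if 2
-- < m < 2k. In both cases g vanishes at l = 0 and another factor l splits off
-- (`SolvesCentered.exists_quotient`). At m = 2k the limit is ∂ₜg = -(|ξ|² + `V2k` y), which gives
-- the leading term.
--
-- Now write Ψ = -tF and expand F(t, rθ, qη) to second order in q. The weighted vanishing forces the
-- form γq² + r^k βq - r^(2k) α, with γ = 1 and α = -`V2k` θ > 0 on the exceptional set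
-- (`SolvesCentered.exists_quadratic_form`). Completing the square and extracting a 2k-th root gives
-- χ₁ and χ₂ (`exists_square_coordinates`). The resulting map is injective with invertible
-- derivative along the compact exceptional set, hence a diffeomorphism of a neighbourhood. It fixes
-- θ and η, so it restricts to the spheres.

universe u

/-! ### Smooth division: Hadamard's lemma with parameters. -/

/-- Differentiation under the integral sign for a smooth integrand on a compact interval. -/
theorem hasFDerivAt_integral_of_contDiff {P F : Type*} [NormedAddCommGroup P] [NormedSpace ℝ P]
    [FiniteDimensional ℝ P] [NormedAddCommGroup F] [NormedSpace ℝ F] [CompleteSpace F]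
    {f : P × ℝ → F} (hf : ContDiff ℝ ∞ f) (p : P) :
    HasFDerivAt (fun p => ∫ s in (0 : ℝ)..1, f (p, s))
      (∫ s in (0 : ℝ)..1, (fderiv ℝ f (p, s)).comp (ContinuousLinearMap.inl ℝ P ℝ)) p := by
  have hcont : Continuous f := hf.continuous
  have hcont' : Continuous fun z : P × ℝ =>
      (fderiv ℝ f z).comp (ContinuousLinearMap.inl ℝ P ℝ) :=
    (hf.continuous_fderiv (by simp)).clm_comp continuous_const
  obtain ⟨C, hC⟩ := ((isCompact_closedBall p 1).prod (isCompact_Icc (a := (0 : ℝ)) (b := 1))).exists_bound_of_continuousOn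
    hcont'.continuousOn
  have hder : ∀ (s : ℝ) (x : P), HasFDerivAt (fun x => f (x, s))
      ((fderiv ℝ f (x, s)).comp (ContinuousLinearMap.inl ℝ P ℝ)) x := fun s x =>
    ((hf.differentiable (by simp)) (x, s)).hasFDerivAt.comp x (hasFDerivAt_prodMk_left x s)
  refine intervalIntegral.hasFDerivAt_integral_of_dominated_of_fderiv_le
    (bound := fun _ => C) (F' := fun x s => (fderiv ℝ f (x, s)).comp (ContinuousLinearMap.inl ℝ P ℝ))
    (Metric.ball_mem_nhds p one_pos)
    ?_ ?_ ?_ ?_ ?_ ?_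
  · exact Eventually.of_forall fun x => (by fun_prop : Continuous fun s => f (x, s)).aestronglyMeasurable
  · exact (by fun_prop : Continuous fun s => f (p, s)).intervalIntegrable _ _
  · exact (hcont'.comp (by fun_prop : Continuous fun s : ℝ => (p, s))).aestronglyMeasurable
  · refine Eventually.of_forall fun s hs x hx => hC (x, s) ⟨Metric.ball_subset_closedBall hx, ?_⟩
    rw [uIoc_of_le zero_le_one] at hs
    exact Ioc_subset_Icc_self hs
  · exact intervalIntegrable_const
  · exact Eventually.of_forall fun s _ x _ => hder s x

/-- A parametric integral of a smooth function over `[0, 1]` is smooth. -/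
theorem contDiff_parametric_integral {P F : Type u} [NormedAddCommGroup P] [NormedSpace ℝ P]
    [FiniteDimensional ℝ P] [NormedAddCommGroup F] [NormedSpace ℝ F] [CompleteSpace F]
    {f : P × ℝ → F} (hf : ContDiff ℝ ∞ f) :
    ContDiff ℝ ∞ fun p => ∫ s in (0 : ℝ)..1, f (p, s) := by
  refine contDiff_infty.2 fun n => ?_
  -- The derivative is an integral of the same kind with values in `P →L[ℝ] F`, so the target varies
  -- in the induction. Sharing one universe between `P` and `F` keeps that space in the same
  -- universe.
  induction n generalizing F with
  | zero =>
    exact contDiff_zero.2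
      (intervalIntegral.continuous_parametric_intervalIntegral_of_continuous'
        (f := fun p s => f (p, s)) hf.continuous 0 1)
  | succ n ih =>
    have h := hasFDerivAt_integral_of_contDiff hf
    push_cast
    refine (contDiff_succ_iff_fderiv (n := n)).2 ⟨fun p => (h p).differentiableAt, by simp, ?_⟩
    rw [funext fun p => (h p).fderiv]
    exact ih (f := fun z => (fderiv ℝ f z).comp (ContinuousLinearMap.inl ℝ P ℝ))
      ((hf.fderiv_right (by simp)).clm_comp contDiff_const)

/-- Hadamard's lemma: division by a coordinate, with parameters. -/
theorem exists_hadamard_quotient {P F : Type u} [NormedAddCommGroup P] [NormedSpace ℝ P]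
    [FiniteDimensional ℝ P] [NormedAddCommGroup F] [NormedSpace ℝ F] [CompleteSpace F]
    {f : P × ℝ → F} (hf : ContDiff ℝ ∞ f) :
    ∃ g : P × ℝ → F, ContDiff ℝ ∞ g ∧ ∀ p r, f (p, r) = f (p, 0) + r • g (p, r) := by
  -- The difference f(p, r) - f(p, 0) is the integral over s in [0, 1] of the derivative of f(p, s
  -- r), which has a factor r.
  refine ⟨fun z => ∫ s in (0 : ℝ)..1, fderiv ℝ f (z.1, s * z.2) (0, 1), ?_, fun p r => ?_⟩
  · refine contDiff_parametric_integral
      (f := fun z : (P × ℝ) × ℝ => fderiv ℝ f (z.1.1, z.2 * z.1.2) (0, 1)) ?_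
    exact ((hf.fderiv_right (m := ∞) (by simp)).comp
      (by fun_prop : ContDiff ℝ ∞ fun z : (P × ℝ) × ℝ => (z.1.1, z.2 * z.1.2))).clm_apply
      contDiff_const
  · have hd : ∀ s : ℝ, HasDerivAt (fun s => f (p, s * r)) (r • fderiv ℝ f (p, s * r) (0, 1)) s := by
      intro s
      have h1 : HasDerivAt (fun s : ℝ => (p, s * r)) ((0 : P), r) s := by
        simpa using (hasDerivAt_const s p).prodMk ((hasDerivAt_id s).mul_const r)
      have h2 := ((hf.differentiable (by simp)) (p, s * r)).hasFDerivAt.comp_hasDerivAt s h1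
      rw [← map_smul]
      simpa [Function.comp_def] using h2
    have hc : Continuous fun s : ℝ => fderiv ℝ f (p, s * r) ((0 : P), (1 : ℝ)) :=
      ((hf.continuous_fderiv (by simp)).comp (by fun_prop)).clm_apply continuous_const
    have := intervalIntegral.integral_eq_sub_of_hasDerivAt (a := 0) (b := 1)
      (fun s _ => hd s) ((hc.const_smul r).intervalIntegrable _ _)
    rw [intervalIntegral.integral_smul] at this
    simp only [this]
    simp

/-- If a function vanishes on `r = 0` over a set of parameters, it is there a smooth multiple
of `r`. -/
theorem exists_quotient_of_eq_zero {P F : Type u} [NormedAddCommGroup P] [NormedSpace ℝ P]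
    [FiniteDimensional ℝ P] [NormedAddCommGroup F] [NormedSpace ℝ F] [CompleteSpace F]
    {f : P × ℝ → F} (hf : ContDiff ℝ ∞ f) :
    ∃ g : P × ℝ → F, ContDiff ℝ ∞ g ∧ ∀ p, f (p, 0) = 0 → ∀ r, f (p, r) = r • g (p, r) := by
  obtain ⟨g, hg, h⟩ := exists_hadamard_quotient hf
  exact ⟨g, hg, fun p hp r => by rw [h, hp, zero_add]⟩

/-! ### Hamilton-Jacobi equations at a critical point of the potential. -/

section Gradient

variable {E X : Type*} [NormedAddCommGroup E] [InnerProductSpace ℝ E] [CompleteSpace E]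
  [NormedAddCommGroup X] [NormedSpace ℝ X]

/-- The gradient of `g` along the directions in the image of `ι`. -/
noncomputable def partialGradient (ι : E →L[ℝ] X) (g : X → ℝ) (x : X) : E :=
  (InnerProductSpace.toDual ℝ E).symm ((fderiv ℝ g x).comp ι)

theorem inner_partialGradient (ι : E →L[ℝ] X) (g : X → ℝ) (x : X) (v : E) :
    inner ℝ (partialGradient ι g x) v = fderiv ℝ g x (ι v) := by
  simp [partialGradient]

theorem ContDiff.partialGradient (ι : E →L[ℝ] X) {g : X → ℝ} (hg : ContDiff ℝ ∞ g) :
    ContDiff ℝ ∞ (partialGradient ι g) :=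
  (InnerProductSpace.toDual ℝ E).symm.toContinuousLinearEquiv.contDiff.comp
    ((hg.fderiv_right (m := ∞) (by simp)).clm_comp contDiff_const)

theorem partialGradient_eq_of_forall {ι : E →L[ℝ] X} {g : X → ℝ} {x : X} {w : E}
    (h : ∀ v, fderiv ℝ g x (ι v) = inner ℝ w v) : partialGradient ι g x = w :=
  ext_inner_right ℝ fun v => by rw [inner_partialGradient, h]

end Gradient

/-- A solution of a linear differential inequality that vanishes at time zero vanishes. -/
theorem eq_zero_of_norm_deriv_le {F : Type*} [NormedAddCommGroup F] [NormedSpace ℝ F]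
    {φ φ' : ℝ → F} {K : ℝ → ℝ} {τ : ℝ} (hK : Continuous K)
    (hφ : ∀ t, |t| < τ → HasDerivAt φ (φ' t) t) (h0 : φ 0 = 0)
    (hb : ∀ t, |t| < τ → ‖φ' t‖ ≤ K t * ‖φ t‖) (t : ℝ) (ht : |t| < τ) : φ t = 0 := by
  -- Gronwall forward in time, with K bounded on the compact interval [0, t]. Negative times follow
  -- by reflection.
  have key : ∀ (ψ ψ' : ℝ → F) (M : ℝ → ℝ), Continuous M →
      (∀ t, |t| < τ → HasDerivAt ψ (ψ' t) t) → ψ 0 = 0 →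
      (∀ t, |t| < τ → ‖ψ' t‖ ≤ M t * ‖ψ t‖) → ∀ t, 0 ≤ t → t < τ → ψ t = 0 := by
    intro ψ ψ' M hM hψ hψ0 hψb t ht0 ht
    obtain ⟨C, hC⟩ := (isCompact_Icc (a := (0 : ℝ)) (b := t)).exists_bound_of_continuousOn
      hM.continuousOn
    have hs : ∀ s ∈ Icc 0 t, |s| < τ := fun s hs => by
      rw [abs_of_nonneg hs.1]; exact hs.2.trans_lt ht
    refine eq_zero_of_abs_deriv_le_mul_abs_self_of_eq_zero_right (K := C) (a := 0) (b := t)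
      (fun s h => (hψ s (hs s h)).continuousAt.continuousWithinAt)
      (fun s h => (hψ s (hs s (Ico_subset_Icc_self h))).hasDerivWithinAt) hψ0
      (fun s h => (hψb s (hs s (Ico_subset_Icc_self h))).trans ?_) t ⟨ht0, le_rfl⟩
    exact mul_le_mul_of_nonneg_right
      ((le_abs_self _).trans (hC s (Ico_subset_Icc_self h))) (norm_nonneg _)
  rcases le_total 0 t with h | h
  · exact key φ φ' K hK hφ h0 hb t h (by rwa [abs_of_nonneg h] at ht)
  · have := key (fun s => φ (-s)) (fun s => -φ' (-s)) (fun s => K (-s)) (by fun_prop)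
      (fun s hs => by
        have := (hφ (-s) (by rwa [abs_neg])).scomp s (hasDerivAt_neg s)
        simpa [Function.comp_def] using this)
      (by simpa using h0) (fun s hs => by simpa using hb (-s) (by rwa [abs_neg])) (-t)
      (by linarith) (by rwa [abs_of_nonpos h] at ht)
    simpa using this

/-- A smooth solution of a Hamilton-Jacobi equation `∂ₜU + |∇U|² + w = 0` with zero initial value
stays critical at a critical point of the potential `w`. -/
theorem gradient_eq_zero_of_hamiltonJacobi {E : Type*} [NormedAddCommGroup E]
    [InnerProductSpace ℝ E] [CompleteSpace E] {U : ℝ × E → ℝ} (hU : ContDiff ℝ ∞ U)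
    {w : E → ℝ} {y₀ : E} (hw : HasFDerivAt w (0 : E →L[ℝ] ℝ) y₀) {τ : ℝ}
    (hHJ : ∀ t, |t| < τ → ∀ᶠ y in 𝓝 y₀, fderiv ℝ U (t, y) (1, 0)
      + ‖partialGradient (ContinuousLinearMap.inr ℝ ℝ E) U (t, y)‖ ^ 2 + w y = 0)
    (h0 : ∀ y, U (0, y) = 0) (t : ℝ) (ht : |t| < τ) :
    partialGradient (ContinuousLinearMap.inr ℝ ℝ E) U (t, y₀) = 0 := by
  set Q : ℝ × E → E := partialGradient (ContinuousLinearMap.inr ℝ ℝ E) U with hQdef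
  have hQ : ContDiff ℝ ∞ Q := ContDiff.partialGradient _ hU
  have hQd : ∀ z, HasFDerivAt Q (fderiv ℝ Q z) z := fun z =>
    (hQ.differentiable (by simp) z).hasFDerivAt
  have hU' : ContDiff ℝ ∞ (fderiv ℝ U) := hU.fderiv_right (by simp)
  have hU'd : ∀ z, HasFDerivAt (fderiv ℝ U) (fderiv ℝ (fderiv ℝ U) z) z := fun z =>
    (hU'.differentiable (by simp) z).hasFDerivAt
  have hsymm : ∀ z, IsSymmSndFDerivAt ℝ U z := fun z =>
    (contDiff_infty.1 hU 2).contDiffAt.isSymmSndFDerivAt (by simp)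
  have hinner : ∀ z a v, inner ℝ (fderiv ℝ Q z a) v = fderiv ℝ (fderiv ℝ U) z a (0, v) := by
    intro z a v
    have h1 : HasFDerivAt (fun z => inner ℝ (Q z) v) ((innerSL ℝ v).comp (fderiv ℝ Q z)) z := by
      simpa [real_inner_comm, Function.comp_def] using ((innerSL ℝ v).hasFDerivAt.comp z (hQd z))
    have h2 : HasFDerivAt (fun z => inner ℝ (Q z) v)
        ((fderiv ℝ (fderiv ℝ U) z).flip ((0 : ℝ), v)) z := by
      have : (fun z => inner ℝ (Q z) v) = fun z => fderiv ℝ U z (0, v) := by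
        ext z; rw [hQdef, inner_partialGradient]; simp
      rw [this]
      have := (hU'd z).clm_apply (hasFDerivAt_const ((0 : ℝ), v) z)
      simpa using this
    have := congrArg (fun L => L a) (h1.unique h2)
    simpa [real_inner_comm] using this
  -- Differentiate the equation in the direction v and exchange ∂ₜ with ∂_v. The potential drops out
  -- because y₀ is critical for it.
  have hder : ∀ t, |t| < τ → ∀ v, inner ℝ (fderiv ℝ Q (t, y₀) (1, 0)) v =
      -2 * inner ℝ (Q (t, y₀)) (fderiv ℝ Q (t, y₀) (0, v)) := by
    intro t ht v
    rw [hinner, (hsymm (t, y₀)).eq]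
    have hin : HasFDerivAt (fun y : E => (t, y)) (ContinuousLinearMap.inr ℝ ℝ E) y₀ :=
      hasFDerivAt_prodMk_right t y₀
    have h1 : HasFDerivAt (fun y => fderiv ℝ U (t, y) (1, 0))
        (((fderiv ℝ (fderiv ℝ U) (t, y₀)).comp (ContinuousLinearMap.inr ℝ ℝ E)).flip (1, 0)) y₀ := by
      have h := HasFDerivAt.comp (g := fderiv ℝ U) y₀ (hU'd (t, y₀)) hin
      simpa [Function.comp_def] using h.clm_apply (hasFDerivAt_const ((1 : ℝ), (0 : E)) y₀)
    have h2 := (((hQd (t, y₀)).comp y₀ hin).norm_sq.add hw).neg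
    have h3 : (fun y => fderiv ℝ U (t, y) (1, 0)) =ᶠ[𝓝 y₀]
        fun y => -(‖Q (t, y)‖ ^ 2 + w y) := by
      filter_upwards [hHJ t ht] with y hy
      linarith
    have := congrArg (fun L => L v) (h1.unique (h2.congr_of_eventuallyEq h3))
    simpa using this
  refine eq_zero_of_norm_deriv_le (φ := fun t => Q (t, y₀))
    (φ' := fun t => fderiv ℝ Q (t, y₀) (1, 0))
    (K := fun t => 2 * ‖fderiv ℝ Q (t, y₀)‖) (τ := τ) ?_ ?_ ?_ ?_ t ht
  · exact continuous_const.mul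
      (((hQ.continuous_fderiv (by simp)).comp (by fun_prop)).norm)
  · intro t _
    have : HasDerivAt (fun t : ℝ => (t, y₀)) ((1 : ℝ), (0 : E)) t :=
      (hasDerivAt_id t).prodMk (hasDerivAt_const t y₀)
    exact (hQd (t, y₀)).comp_hasDerivAt t this
  · refine partialGradient_eq_of_forall fun v => ?_
    have h1 : HasFDerivAt (fun y : E => U (0, y))
        ((fderiv ℝ U (0, y₀)).comp (ContinuousLinearMap.inr ℝ ℝ E)) y₀ :=
      ((hU.differentiable (by simp)) _).hasFDerivAt.comp y₀ (hasFDerivAt_prodMk_right 0 y₀)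
    have h2 : HasFDerivAt (fun y : E => U (0, y)) (0 : E →L[ℝ] ℝ) y₀ := by
      rw [funext h0]; exact hasFDerivAt_const _ _
    have := congrArg (fun L => L v) (h1.unique h2)
    simpa using this
  · intro t ht
    set q' := fderiv ℝ Q (t, y₀) (1, 0) with hq'
    -- Testing against v = ∂ₜQ itself and cancelling one factor ‖∂ₜQ‖ gives ‖∂ₜQ‖ ≤ 2‖DQ‖‖Q‖.
    have h := hder t ht q'
    rw [← hq', real_inner_self_eq_norm_sq] at h
    have h1 : ‖fderiv ℝ Q (t, y₀) (0, q')‖ ≤ ‖fderiv ℝ Q (t, y₀)‖ * ‖q'‖ := by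
      refine ((fderiv ℝ Q (t, y₀)).le_opNorm _).trans_eq ?_
      simp
    have h2 := abs_real_inner_le_norm (Q (t, y₀)) (fderiv ℝ Q (t, y₀) (0, q'))
    have h3 : ‖q'‖ ^ 2 ≤ 2 * (‖Q (t, y₀)‖ * (‖fderiv ℝ Q (t, y₀)‖ * ‖q'‖)) := by
      rw [h]
      have := (abs_le.1 h2).1
      have := mul_le_mul_of_nonneg_left h1 (norm_nonneg (Q (t, y₀)))
      linarith
    rcases (norm_nonneg q').eq_or_lt with h4 | h4
    · rw [← h4]; positivity
    · refine le_of_mul_le_mul_right ?_ h4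
      calc ‖q'‖ * ‖q'‖ = ‖q'‖ ^ 2 := by ring
        _ ≤ _ := h3
        _ = _ := by ring

/-- Identities obtained by dividing by l, t, r or s hold only off zero; this extends them by
continuity. -/
theorem eq_of_eventuallyEq_punctured {Y : Type*} [TopologicalSpace Y] [T2Space Y] {f g : ℝ → Y}
    {a : ℝ} (hf : ContinuousAt f a) (hg : ContinuousAt g a) (h : f =ᶠ[𝓝[≠] a] g) : f a = g a :=
  tendsto_nhds_unique (hf.tendsto.mono_left nhdsWithin_le_nhds)
    ((hg.tendsto.mono_left nhdsWithin_le_nhds).congr' h.symm)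

theorem hasDerivAt_scaled_time {E : Type*} [NormedAddCommGroup E]
    [NormedSpace ℝ E] {g : (ℝ × E × E) × ℝ → ℝ} (hg : ContDiff ℝ ∞ g) (t : ℝ) (y ξ : E)
    (l : ℝ) : HasDerivAt (fun s => g ((s, y, ξ), l)) (fderiv ℝ g ((t, y, ξ), l) ((1, 0, 0), 0)) t :=
  ((hg.differentiable (by simp)) ((t, y, ξ), l)).hasFDerivAt.comp_hasDerivAt t
    (((hasDerivAt_id t).prodMk (hasDerivAt_const t (y, ξ))).prodMk (hasDerivAt_const t l))

/-! ### The equation under the scaling (y, ξ) ↦ (l y, l^k ξ). -/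

section Scaling

variable {E : Type} [NormedAddCommGroup E] [InnerProductSpace ℝ E] [FiniteDimensional ℝ E]

/-- The inclusion of the position variable in the space of points `(t, y, ξ)`. -/
abbrev positionIncl (E : Type) [NormedAddCommGroup E] [InnerProductSpace ℝ E] :
    E →L[ℝ] ℝ × E × E :=
  (ContinuousLinearMap.inr ℝ ℝ (E × E)).comp (ContinuousLinearMap.inl ℝ E E)

/-- The inclusion of the position variable in the space of points `((t, y, ξ), l)`. -/
abbrev scaledPositionIncl (E : Type) [NormedAddCommGroup E] [InnerProductSpace ℝ E] :
    E →L[ℝ] (ℝ × E × E) × ℝ :=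
  (ContinuousLinearMap.inl ℝ (ℝ × E × E) ℝ).comp (positionIncl E)

/-- `Ψ` is a smooth function which solves, for times `|t| < τ` and near the origin, the equation
`∂ₜΨ + |∇_yΨ + ξ|² + v(y) = 0`, and vanishes at time zero. -/
structure SolvesCentered (Ψ : ℝ × E × E → ℝ) (v : E → ℝ) (τ ρ : ℝ) : Prop where
  pos : 0 < τ
  radius_pos : 0 < ρ
  smooth : ContDiff ℝ ∞ Ψ
  equation : ∀ (t : ℝ) (y ξ : E), |t| < τ → ‖y‖ < ρ → ‖ξ‖ < ρ →
    fderiv ℝ Ψ (t, y, ξ) (1, 0, 0) + ‖partialGradient (positionIncl E) Ψ (t, y, ξ) + ξ‖ ^ 2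
      + v y = 0
  initial : ∀ y ξ : E, Ψ (0, y, ξ) = 0

/-- The potential `v` vanishes at the origin to order `2k`, with leading part `v2k`. -/
structure HasLeadingPart (v v2k : E → ℝ) (k : ℕ) : Prop where
  two_le : 2 ≤ k
  eq_zero : v 0 = 0
  fderiv_eq_zero : HasFDerivAt v (0 : E →L[ℝ] ℝ) 0
  tendsto : ∀ y, Tendsto (fun l : ℝ => v (l • y) / l ^ (2 * k)) (𝓝[≠] 0) (𝓝 (v2k y))

variable {Ψ : ℝ × E × E → ℝ} {v v2k : E → ℝ} {τ ρ : ℝ} {k m : ℕ}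

/-- This is l² times the equation for Ψ: by the chain rule l ∇Ψ = l^m ∇g, so the factor l² avoids
any division. It holds for small l only, since the scaled point must stay in the ball of radius ρ.
-/
theorem SolvesCentered.scaled_equation (h : SolvesCentered Ψ v τ ρ) (hk : k ≠ 0)
    {g : (ℝ × E × E) × ℝ → ℝ} (hg : ContDiff ℝ ∞ g)
    (hfg : ∀ t, |t| < τ → ∀ (y ξ : E) (l : ℝ), Ψ (t, l • y, l ^ k • ξ) = l ^ m * g ((t, y, ξ), l))
    {t : ℝ} (ht : |t| < τ) (y ξ : E) : ∀ᶠ l : ℝ in 𝓝[≠] 0,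
      l ^ (m + 2) * fderiv ℝ g ((t, y, ξ), l) ((1, 0, 0), 0)
        + ‖l ^ m • partialGradient (scaledPositionIncl E) g ((t, y, ξ), l) + l ^ (k + 1) • ξ‖ ^ 2
        + l ^ 2 * v (l • y) = 0 := by
  have hΨd : ∀ z, HasFDerivAt Ψ (fderiv ℝ Ψ z) z := fun z =>
    (h.smooth.differentiable (by simp) z).hasFDerivAt
  have hgd : ∀ z, HasFDerivAt g (fderiv ℝ g z) z := fun z =>
    (hg.differentiable (by simp) z).hasFDerivAt
  have e1 : ∀ᶠ l : ℝ in 𝓝 0, ‖l • y‖ < ρ := by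
    have : Tendsto (fun l : ℝ => ‖l • y‖) (𝓝 0) (𝓝 ‖(0 : ℝ) • y‖) :=
      (by fun_prop : Continuous fun l : ℝ => ‖l • y‖).tendsto 0
    exact this.eventually (gt_mem_nhds (by simpa using h.radius_pos))
  have e2 : ∀ᶠ l : ℝ in 𝓝 0, ‖l ^ k • ξ‖ < ρ := by
    have : Tendsto (fun l : ℝ => ‖l ^ k • ξ‖) (𝓝 0) (𝓝 ‖(0 : ℝ) ^ k • ξ‖) :=
      (by fun_prop : Continuous fun l : ℝ => ‖l ^ k • ξ‖).tendsto 0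
    exact this.eventually (gt_mem_nhds (by simpa [zero_pow hk] using h.radius_pos))
  filter_upwards [nhdsWithin_le_nhds e1, nhdsWithin_le_nhds e2] with l h1 h2
  have ht' : ∀ᶠ s in 𝓝 t, |s| < τ := (continuous_abs.tendsto t).eventually (gt_mem_nhds ht)
  have htime : fderiv ℝ Ψ (t, l • y, l ^ k • ξ) (1, 0, 0)
      = l ^ m * fderiv ℝ g ((t, y, ξ), l) ((1, 0, 0), 0) := by
    have d1 : HasDerivAt (fun s => Ψ (s, l • y, l ^ k • ξ))
        (fderiv ℝ Ψ (t, l • y, l ^ k • ξ) (1, 0, 0)) t :=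
      (hΨd _).comp_hasDerivAt t
        ((hasDerivAt_id t).prodMk (hasDerivAt_const t (l • y, l ^ k • ξ)))
    have d2 := (hasDerivAt_scaled_time hg t y ξ l).const_mul (l ^ m)
    refine d1.unique (d2.congr_of_eventuallyEq ?_)
    filter_upwards [ht'] with s hs using hfg s hs y ξ l
  have hspace : l • partialGradient (positionIncl E) Ψ (t, l • y, l ^ k • ξ)
      = l ^ m • partialGradient (scaledPositionIncl E) g ((t, y, ξ), l) := by
    refine ext_inner_right ℝ fun w => ?_
    rw [inner_smul_left, inner_smul_left, inner_partialGradient, inner_partialGradient]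
    have c1 : HasDerivAt (fun s : ℝ => (t, l • (y + s • w), l ^ k • ξ)) ((0 : ℝ), l • w, (0 : E)) 0 := by
      have : HasDerivAt (fun s : ℝ => l • (y + s • w)) (l • w) 0 := by
        have := (((hasDerivAt_id (0 : ℝ)).smul_const w).const_add y).const_smul l
        rw [one_smul] at this
        exact this
      exact (hasDerivAt_const 0 t).prodMk (this.prodMk (hasDerivAt_const 0 (l ^ k • ξ)))
    have c2 : HasDerivAt (fun s : ℝ => ((t, y + s • w, ξ), l)) (((0 : ℝ), w, (0 : E)), (0 : ℝ)) 0 := by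
      have : HasDerivAt (fun s : ℝ => y + s • w) w 0 := by
        simpa using ((hasDerivAt_id (0 : ℝ)).smul_const w).const_add y
      exact ((hasDerivAt_const 0 t).prodMk (this.prodMk (hasDerivAt_const 0 ξ))).prodMk
        (hasDerivAt_const 0 l)
    have d1 := HasFDerivAt.comp_hasDerivAt_of_eq (0 : ℝ) (hΨd (t, l • y, l ^ k • ξ)) c1 (by simp)
    have d2 := (HasFDerivAt.comp_hasDerivAt_of_eq (0 : ℝ) (hgd ((t, y, ξ), l)) c2
      (by simp)).const_mul (l ^ m)
    have := d1.unique (d2.congr_of_eventuallyEq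
      (Eventually.of_forall fun s => hfg t ht (y + s • w) ξ l))
    have e : ((0 : ℝ), l • w, (0 : E)) = l • ((0 : ℝ), w, (0 : E)) := by simp
    rw [e, map_smul] at this
    simpa using this
  have heq := h.equation t (l • y) (l ^ k • ξ) ht h1 h2
  rw [← hspace, pow_succ' l k, mul_smul l (l ^ k), ← smul_add, norm_smul, mul_pow, Real.norm_eq_abs, sq_abs,
    pow_add, mul_right_comm, ← htime]
  linear_combination l ^ 2 * heq

/-- The limit `l → 0` of the scaled equation. -/
theorem SolvesCentered.scaled_limit (h : SolvesCentered Ψ v τ ρ) (hv : HasLeadingPart v v2k k)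
    {g : (ℝ × E × E) × ℝ → ℝ} (hg : ContDiff ℝ ∞ g) (hm : 2 ≤ m) (hmk : m ≤ 2 * k)
    (hfg : ∀ t, |t| < τ → ∀ (y ξ : E) (l : ℝ), Ψ (t, l • y, l ^ k • ξ) = l ^ m * g ((t, y, ξ), l))
    {t : ℝ} (ht : |t| < τ) (y ξ : E) :
    fderiv ℝ g ((t, y, ξ), 0) ((1, 0, 0), 0)
      + 0 ^ (m - 2) * ‖partialGradient (scaledPositionIncl E) g ((t, y, ξ), 0)‖ ^ 2
      + 0 ^ (2 * k - m) * (‖ξ‖ ^ 2 + v2k y) = 0 := by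
  have hk := hv.two_le
  have ca : Continuous fun l : ℝ => fderiv ℝ g ((t, y, ξ), l) ((1, 0, 0), 0) :=
    ((hg.continuous_fderiv (by simp)).comp (by fun_prop)).clm_apply continuous_const
  have cb : Continuous fun l : ℝ => partialGradient (scaledPositionIncl E) g ((t, y, ξ), l) :=
    (ContDiff.partialGradient _ hg).continuous.comp (by fun_prop)
  set a := fun l : ℝ => fderiv ℝ g ((t, y, ξ), l) ((1, 0, 0), 0) with ha
  set b := fun l : ℝ => partialGradient (scaledPositionIncl E) g ((t, y, ξ), l) with hb
  -- This is the scaled equation divided by l^(m+2). The cross term carries l^(k-1) and dies since k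
  -- ≥ 2. With 0 ^ 0 = 1, the other powers keep the gradient term exactly for m = 2 and the
  -- potential exactly for m = 2k.
  have lim : Tendsto (fun l : ℝ => a l + l ^ (m - 2) * ‖b l‖ ^ 2
      + 2 * l ^ (k - 1) * inner ℝ (b l) ξ + l ^ (2 * k - m) * (‖ξ‖ ^ 2 + v (l • y) / l ^ (2 * k)))
      (𝓝[≠] 0) (𝓝 (a 0 + 0 ^ (m - 2) * ‖b 0‖ ^ 2 + 2 * 0 ^ (k - 1) * inner ℝ (b 0) ξ
        + 0 ^ (2 * k - m) * (‖ξ‖ ^ 2 + v2k y))) := by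
    refine Tendsto.add ?_ (Tendsto.mul ?_ (tendsto_const_nhds.add (hv.tendsto y)))
    · exact ((by fun_prop : Continuous fun l : ℝ => a l + l ^ (m - 2) * ‖b l‖ ^ 2
        + 2 * l ^ (k - 1) * inner ℝ (b l) ξ).tendsto 0).mono_left nhdsWithin_le_nhds
    · exact ((continuous_pow _).tendsto 0).mono_left nhdsWithin_le_nhds
  have hzero : Tendsto (fun _ : ℝ => (0 : ℝ)) (𝓝[≠] (0 : ℝ)) (𝓝 0) := tendsto_const_nhds
  have := tendsto_nhds_unique (lim.congr' ?_) hzero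
  · rw [zero_pow (by omega : k - 1 ≠ 0)] at this
    simpa using this
  · filter_upwards [h.scaled_equation (by omega) hg hfg ht y ξ, self_mem_nhdsWithin] with l hl hl0
    have hl0 : l ≠ 0 := hl0
    rw [norm_add_sq_real, norm_smul, norm_smul, inner_smul_left, inner_smul_right] at hl
    simp only [Real.norm_eq_abs, mul_pow, sq_abs, conj_trivial] at hl
    refine (mul_eq_zero.1 (?_ : l ^ (m + 2) * _ = 0)).resolve_left (pow_ne_zero _ hl0)
    obtain ⟨j, rfl⟩ := Nat.exists_eq_add_of_le hm
    obtain ⟨i, hi⟩ := Nat.exists_eq_add_of_le hmk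
    obtain ⟨k', rfl⟩ := Nat.exists_eq_add_of_le (show 1 ≤ k by omega)
    have e1 : 2 + j - 2 = j := by omega
    have e2 : 1 + k' - 1 = k' := by omega
    have e3 : 2 * (1 + k') - (2 + j) = i := by omega
    have e4 : l ^ (2 + j + 2) * (l ^ i * (v (l • y) / l ^ (2 * (1 + k')))) = l ^ 2 * v (l • y) := by
      have : l ^ (2 + j + 2) * l ^ i = l ^ 2 * l ^ (2 * (1 + k')) := by
        rw [← pow_add, ← pow_add]; congr 1; omega
      field_simp
      linear_combination v (l • y) * this
    have e5 : l ^ (2 + j + 2) * l ^ i = (l ^ (1 + k' + 1)) ^ 2 := by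
      rw [← pow_add, ← pow_mul]; congr 1; omega
    rw [e1, e2, e3, mul_add, mul_add, mul_add, mul_add (l ^ i), mul_add (l ^ (2 + j + 2)), e4,
      ← mul_assoc _ (l ^ i), e5, ← hl]
    ring

end Scaling

/-! ### Vanishing of the phase to weighted order 2k. -/

section ScalingInduction

variable {E : Type} [NormedAddCommGroup E] [InnerProductSpace ℝ E] [FiniteDimensional ℝ E]
  {Ψ : ℝ × E × E → ℝ} {v v2k : E → ℝ} {τ ρ : ℝ} {k m : ℕ}

theorem SolvesCentered.quotient_initial (h : SolvesCentered Ψ v τ ρ)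
    {g : (ℝ × E × E) × ℝ → ℝ} (hg : ContDiff ℝ ∞ g)
    (hfg : ∀ t, |t| < τ → ∀ (y ξ : E) (l : ℝ), Ψ (t, l • y, l ^ k • ξ) = l ^ m * g ((t, y, ξ), l))
    (y ξ : E) (l : ℝ) : g ((0, y, ξ), l) = 0 := by
  have hne : ∀ l : ℝ, l ≠ 0 → g ((0, y, ξ), l) = 0 := fun l hl => by
    have := hfg 0 (by simpa using h.pos) y ξ l
    rw [h.initial] at this
    exact (mul_eq_zero.1 this.symm).resolve_left (pow_ne_zero _ hl)
  rcases eq_or_ne l 0 with rfl | hl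
  · refine eq_of_eventuallyEq_punctured (f := fun l => g ((0, y, ξ), l)) (g := fun _ => 0)
      (hg.continuous.comp (by fun_prop)).continuousAt continuousAt_const ?_
    filter_upwards [self_mem_nhdsWithin] with l hl using hne l hl
  · exact hne l hl

/-- On ξ = 0 the equation is a Hamilton-Jacobi equation with potential v, for which the origin is
critical. -/
theorem SolvesCentered.gradient_origin (h : SolvesCentered Ψ v τ ρ) (hv : HasLeadingPart v v2k k)
    {t : ℝ} (ht : |t| < τ) : partialGradient (positionIncl E) Ψ (t, 0, 0) = 0 := by
  have hA : ∀ z : ℝ × E, HasFDerivAt (fun z : ℝ × E => Ψ (z.1, z.2, 0))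
      ((fderiv ℝ Ψ (z.1, z.2, 0)).comp
        ((ContinuousLinearMap.fst ℝ ℝ E).prod ((ContinuousLinearMap.snd ℝ ℝ E).prod 0))) z := by
    intro z
    exact HasFDerivAt.comp z (h.smooth.differentiable (by simp) _).hasFDerivAt
      (hasFDerivAt_fst.prodMk (hasFDerivAt_snd.prodMk (hasFDerivAt_const (0 : E) z)))
  have hU : ContDiff ℝ ∞ fun z : ℝ × E => Ψ (z.1, z.2, 0) := h.smooth.comp (by fun_prop)
  have hgrad : ∀ z : ℝ × E, partialGradient (ContinuousLinearMap.inr ℝ ℝ E)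
      (fun z : ℝ × E => Ψ (z.1, z.2, 0)) z
      = partialGradient (positionIncl E) Ψ (z.1, z.2, 0) := fun z =>
    partialGradient_eq_of_forall fun w => by
      rw [(hA z).fderiv, inner_partialGradient]; simp
  have := gradient_eq_zero_of_hamiltonJacobi hU hv.fderiv_eq_zero (τ := τ) ?_
    (fun y => h.initial y 0) t ht
  · rwa [hgrad] at this
  · intro t ht
    filter_upwards [Metric.ball_mem_nhds (0 : E) h.radius_pos] with y hy
    have := h.equation t y 0 ht (by simpa using hy) (by simpa using h.radius_pos)
    rw [hgrad, (hA _).fderiv]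
    simpa using this

/-- With zero gradient and v(0) = 0 the equation at the origin reduces to ∂ₜΨ = 0. -/
theorem SolvesCentered.apply_origin (h : SolvesCentered Ψ v τ ρ) (hv : HasLeadingPart v v2k k)
    {t : ℝ} (ht : |t| < τ) : Ψ (t, 0, 0) = 0 := by
  refine eq_zero_of_norm_deriv_le (φ := fun t => Ψ (t, 0, 0)) (φ' := fun _ => 0) (K := 0)
    (τ := τ) continuous_const (fun t ht => ?_) (h.initial 0 0) (by simp) t ht
  have h1 := h.equation t 0 0 ht (by simpa using h.radius_pos) (by simpa using h.radius_pos)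
  rw [h.gradient_origin hv ht, hv.eq_zero] at h1
  have h2 : fderiv ℝ Ψ (t, 0, 0) (1, 0, 0) = 0 := by simpa using h1
  rw [← h2]
  exact (h.smooth.differentiable (by simp) (t, 0, 0)).hasFDerivAt.comp_hasDerivAt t
    ((hasDerivAt_id t).prodMk (hasDerivAt_const t ((0 : E), (0 : E))))

/-- Since k ≥ 2, l^k ξ does not contribute at first order in l. Only the y-gradient at the origin
matters, and it vanishes. -/
theorem SolvesCentered.exists_quotient_two (h : SolvesCentered Ψ v τ ρ)
    (hv : HasLeadingPart v v2k k) : ∃ g : (ℝ × E × E) × ℝ → ℝ, ContDiff ℝ ∞ g ∧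
      ∀ t, |t| < τ → ∀ (y ξ : E) (l : ℝ), Ψ (t, l • y, l ^ k • ξ) = l ^ 2 * g ((t, y, ξ), l) := by
  have hk := hv.two_le
  obtain ⟨g₁, hg₁, h₁⟩ := exists_quotient_of_eq_zero
    (f := fun z : (ℝ × E × E) × ℝ => Ψ (z.1.1, z.2 • z.1.2.1, z.2 ^ k • z.1.2.2))
    (h.smooth.comp (by fun_prop))
  have h₁' : ∀ t, |t| < τ → ∀ (y ξ : E) (l : ℝ),
      Ψ (t, l • y, l ^ k • ξ) = l * g₁ ((t, y, ξ), l) := fun t ht y ξ l =>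
    h₁ (t, y, ξ) (by simpa [zero_pow (by omega : k ≠ 0)] using h.apply_origin hv ht) l
  obtain ⟨g₂, hg₂, h₂⟩ := exists_quotient_of_eq_zero hg₁
  refine ⟨g₂, hg₂, fun t ht y ξ l => ?_⟩
  rw [h₁' t ht, h₂ (t, y, ξ) ?_ l, smul_eq_mul]
  · ring
  · have c : HasDerivAt (fun l : ℝ => (t, l • y, l ^ k • ξ)) ((0 : ℝ), y, (0 : E)) 0 := by
      have e1 : HasDerivAt (fun l : ℝ => l • y) y 0 := by
        simpa using (hasDerivAt_id (0 : ℝ)).smul_const y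
      have e2 : HasDerivAt (fun l : ℝ => l ^ k • ξ) 0 0 := by
        simpa [zero_pow (by omega : k - 1 ≠ 0)] using (hasDerivAt_pow k (0 : ℝ)).smul_const ξ
      exact (hasDerivAt_const 0 t).prodMk (e1.prodMk e2)
    have d1 := HasFDerivAt.comp_hasDerivAt_of_eq (0 : ℝ)
      (h.smooth.differentiable (by simp) (t, 0, 0)).hasFDerivAt c
      (by simp [zero_pow (by omega : k ≠ 0)])
    have e : fderiv ℝ Ψ (t, 0, 0) (0, y, 0) = 0 := by
      have := inner_partialGradient (positionIncl E) Ψ (t, 0, 0) y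
      rw [h.gradient_origin hv ht] at this
      simpa using this.symm
    rw [e] at d1
    have d2 : HasDerivAt (fun l : ℝ => l * g₁ ((t, y, ξ), l)) (g₁ ((t, y, ξ), 0)) 0 := by
      have hd : DifferentiableAt ℝ (fun l : ℝ => g₁ ((t, y, ξ), l)) 0 :=
        ((hg₁.comp (by fun_prop : ContDiff ℝ ∞ fun l : ℝ => ((t, y, ξ), l))).differentiable
          (by simp)) 0
      have := (hasDerivAt_id (0 : ℝ)).mul hd.hasDerivAt
      rw [id, one_mul, zero_mul, add_zero] at this
      exact this
    exact d2.unique (d1.congr_of_eventuallyEq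
      (Eventually.of_forall fun l => (h₁' t ht y ξ l).symm))

/-- For m > 2 the limit equation says this directly. For m = 2 it also contains |∇g|², but the
potential is then zero, so every point y is critical and the gradient stays zero everywhere. -/
theorem SolvesCentered.quotient_time_deriv_eq_zero (h : SolvesCentered Ψ v τ ρ)
    (hv : HasLeadingPart v v2k k) {g : (ℝ × E × E) × ℝ → ℝ} (hg : ContDiff ℝ ∞ g) (hm : 2 ≤ m)
    (hmk : m < 2 * k)
    (hfg : ∀ t, |t| < τ → ∀ (y ξ : E) (l : ℝ), Ψ (t, l • y, l ^ k • ξ) = l ^ m * g ((t, y, ξ), l))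
    {t : ℝ} (ht : |t| < τ) (y ξ : E) : fderiv ℝ g ((t, y, ξ), 0) ((1, 0, 0), 0) = 0 := by
  have hlim : ∀ t, |t| < τ → ∀ y, fderiv ℝ g ((t, y, ξ), 0) ((1, 0, 0), 0)
      + 0 ^ (m - 2) * ‖partialGradient (scaledPositionIncl E) g ((t, y, ξ), 0)‖ ^ 2 = 0 :=
    fun t ht y => by
      simpa [zero_pow (by omega : 2 * k - m ≠ 0)] using h.scaled_limit hv hg hm hmk.le hfg ht y ξ
  rcases hm.eq_or_lt with rfl | hm
  · have hA : ∀ z : ℝ × E, HasFDerivAt (fun z : ℝ × E => g ((z.1, z.2, ξ), 0))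
        ((fderiv ℝ g ((z.1, z.2, ξ), 0)).comp
          (((ContinuousLinearMap.fst ℝ ℝ E).prod
            ((ContinuousLinearMap.snd ℝ ℝ E).prod 0)).prod 0)) z := by
      intro z
      exact HasFDerivAt.comp z (hg.differentiable (by simp) _).hasFDerivAt
        ((hasFDerivAt_fst.prodMk (hasFDerivAt_snd.prodMk (hasFDerivAt_const ξ z))).prodMk
          (hasFDerivAt_const (0 : ℝ) z))
    have hU : ContDiff ℝ ∞ fun z : ℝ × E => g ((z.1, z.2, ξ), 0) := hg.comp (by fun_prop)
    have hgrad : ∀ z : ℝ × E, partialGradient (ContinuousLinearMap.inr ℝ ℝ E)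
        (fun z : ℝ × E => g ((z.1, z.2, ξ), 0)) z
        = partialGradient (scaledPositionIncl E) g ((z.1, z.2, ξ), 0) := fun z =>
      partialGradient_eq_of_forall fun w => by
        rw [(hA z).fderiv, inner_partialGradient]; simp
    have := gradient_eq_zero_of_hamiltonJacobi hU (hasFDerivAt_const (0 : ℝ) y) (τ := τ) ?_
      (fun y => h.quotient_initial hg hfg y ξ 0) t ht
    · rw [hgrad] at this
      have h1 := hlim t ht y
      simp only at this
      rw [this] at h1
      simpa using h1
    · intro t ht
      refine Eventually.of_forall fun y => ?_
      rw [hgrad, (hA _).fderiv]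
      simpa using hlim t ht y
  · have h1 := hlim t ht y
    rw [zero_pow (by omega : m - 2 ≠ 0)] at h1
    simpa using h1

/-- As long as m < 2k, g at l = 0 is constant in time and initially zero, so Hadamard's lemma
extracts one more factor l. -/
theorem SolvesCentered.exists_quotient (h : SolvesCentered Ψ v τ ρ)
    (hv : HasLeadingPart v v2k k) (hm : 2 ≤ m) (hmk : m ≤ 2 * k) :
    ∃ g : (ℝ × E × E) × ℝ → ℝ, ContDiff ℝ ∞ g ∧
      ∀ t, |t| < τ → ∀ (y ξ : E) (l : ℝ), Ψ (t, l • y, l ^ k • ξ) = l ^ m * g ((t, y, ξ), l) := by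
  induction m, hm using Nat.le_induction with
  | base => exact h.exists_quotient_two hv
  | succ m hm ih =>
    obtain ⟨g, hg, hfg⟩ := ih (by omega)
    obtain ⟨g', hg', h'⟩ := exists_quotient_of_eq_zero hg
    refine ⟨g', hg', fun t ht y ξ l => ?_⟩
    rw [hfg t ht, h' (t, y, ξ) ?_ l, smul_eq_mul]
    · ring
    · refine eq_zero_of_norm_deriv_le (φ := fun t => g ((t, y, ξ), 0)) (φ' := fun _ => 0) (K := 0)
        (τ := τ) continuous_const (fun t ht => ?_) (h.quotient_initial hg hfg y ξ 0) (by simp) t ht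
      have := hasDerivAt_scaled_time hg t y ξ 0
      rwa [h.quotient_time_deriv_eq_zero hv hg hm (by omega) hfg ht y ξ] at this

/-- The phase is `-t l ^ (2k)` times a smooth function in the scaled variables
`(l y, l ^ k ξ)`. -/
theorem SolvesCentered.exists_scaled_profile (h : SolvesCentered Ψ v τ ρ)
    (hv : HasLeadingPart v v2k k) : ∃ G : (ℝ × E × E) × ℝ → ℝ, ContDiff ℝ ∞ G ∧
      (∀ t, |t| < τ → ∀ (y ξ : E) (l : ℝ),
        Ψ (t, l • y, l ^ k • ξ) = -t * (l ^ (2 * k) * G ((t, y, ξ), l))) ∧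
      ∀ t, |t| < τ → ∀ y ξ : E, G ((t, y, ξ), 0) = ‖ξ‖ ^ 2 + v2k y := by
  have hk := hv.two_le
  obtain ⟨g, hg, hfg⟩ := h.exists_quotient hv (m := 2 * k) (by omega) le_rfl
  -- The variables are reordered to make t the last one, the coordinate by which Hadamard's lemma
  -- divides.
  obtain ⟨G, hG, hgG⟩ := exists_quotient_of_eq_zero
    (f := fun z : (E × E × ℝ) × ℝ => -g ((z.2, z.1.1, z.1.2.1), z.1.2.2))
    (hg.comp (by fun_prop)).neg
  have hgG' : ∀ t y ξ l, g ((t, y, ξ), l) = -t * G ((y, ξ, l), t) := by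
    intro t y ξ l
    have := hgG (y, ξ, l) (by simpa using h.quotient_initial hg hfg y ξ l) t
    simp only [smul_eq_mul] at this
    linarith
  have hg0 : ∀ t, |t| < τ → ∀ y ξ : E, g ((t, y, ξ), 0) = -t * (‖ξ‖ ^ 2 + v2k y) := by
    intro t ht y ξ
    have := eq_zero_of_norm_deriv_le (φ := fun t => g ((t, y, ξ), 0) + t * (‖ξ‖ ^ 2 + v2k y))
      (φ' := fun _ => 0) (K := 0) (τ := τ) continuous_const (fun t ht => ?_)
      (by simp [h.quotient_initial hg hfg y ξ 0]) (by simp) t ht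
    · linarith
    · have h1 := h.scaled_limit hv hg (by omega) le_rfl hfg ht y ξ
      have h2 := (hasDerivAt_scaled_time hg t y ξ 0).add
        ((hasDerivAt_id t).mul_const (‖ξ‖ ^ 2 + v2k y))
      have h3 : fderiv ℝ g ((t, y, ξ), 0) ((1, 0, 0), 0) + 1 * (‖ξ‖ ^ 2 + v2k y) = 0 := by
        simpa [zero_pow (by omega : 2 * k - 2 ≠ 0)] using h1
      rw [h3] at h2
      exact h2
  refine ⟨fun z => G ((z.1.2.1, z.1.2.2, z.2), z.1.1), hG.comp (by fun_prop), ?_, ?_⟩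
  · intro t ht y ξ l
    rw [hfg t ht, hgG']
    ring
  · have hne : ∀ t, |t| < τ → t ≠ 0 → ∀ y ξ : E, G ((y, ξ, 0), t) = ‖ξ‖ ^ 2 + v2k y := by
      intro t ht ht0 y ξ
      have := hg0 t ht y ξ
      rw [hgG'] at this
      exact mul_left_cancel₀ (neg_ne_zero.2 ht0) this
    intro t ht y ξ
    rcases eq_or_ne t 0 with rfl | ht0
    · refine eq_of_eventuallyEq_punctured (f := fun t => G ((y, ξ, 0), t))
        (g := fun _ => ‖ξ‖ ^ 2 + v2k y) (hG.continuous.comp (by fun_prop)).continuousAt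
        continuousAt_const ?_
      filter_upwards [self_mem_nhdsWithin, nhdsWithin_le_nhds
        ((continuous_abs.tendsto 0).eventually (gt_mem_nhds ht))] with t h1 h2
      exact hne t h2 h1 y ξ
    · exact hne t ht ht0 y ξ

end ScalingInduction

/-! ### The quadratic form in polar coordinates. -/

section QuadraticForm

variable {E : Type} [NormedAddCommGroup E] [InnerProductSpace ℝ E] [FiniteDimensional ℝ E]
  {Ψ : ℝ × E × E → ℝ} {v v2k : E → ℝ} {τ ρ : ℝ} {k : ℕ}

/-- F is smooth in the unscaled variables, so it can be expanded in q; G records its weighted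
vanishing. Both are needed together to factor powers of r out of the Taylor coefficients. -/
theorem SolvesCentered.exists_time_quotient (h : SolvesCentered Ψ v τ ρ)
    (hv : HasLeadingPart v v2k k) : ∃ (F : ℝ × E × E → ℝ) (G : (ℝ × E × E) × ℝ → ℝ),
      ContDiff ℝ ∞ F ∧ ContDiff ℝ ∞ G ∧ (∀ t y ξ, Ψ (t, y, ξ) = -t * F (t, y, ξ)) ∧
      (∀ t, |t| < τ → ∀ (y ξ : E) (l : ℝ),
        F (t, l • y, l ^ k • ξ) = l ^ (2 * k) * G ((t, y, ξ), l)) ∧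
      ∀ t, |t| < τ → ∀ y ξ : E, G ((t, y, ξ), 0) = ‖ξ‖ ^ 2 + v2k y := by
  obtain ⟨G, hG, hΨG, hG0⟩ := h.exists_scaled_profile hv
  obtain ⟨F, hF, hΨF⟩ := exists_quotient_of_eq_zero
    (f := fun z : (E × E) × ℝ => -Ψ (z.2, z.1.1, z.1.2)) (h.smooth.comp (by fun_prop)).neg
  have hΨF' : ∀ t y ξ, Ψ (t, y, ξ) = -t * F ((y, ξ), t) := by
    intro t y ξ
    have := hΨF (y, ξ) (by simpa using h.initial y ξ) t
    simp only [smul_eq_mul] at this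
    linarith
  refine ⟨fun z => F (z.2, z.1), G, hF.comp (by fun_prop), hG, hΨF', ?_, hG0⟩
  have hne : ∀ t, |t| < τ → t ≠ 0 → ∀ (y ξ : E) (l : ℝ),
      F ((l • y, l ^ k • ξ), t) = l ^ (2 * k) * G ((t, y, ξ), l) := by
    intro t ht ht0 y ξ l
    have := hΨG t ht y ξ l
    rw [hΨF'] at this
    exact mul_left_cancel₀ (neg_ne_zero.2 ht0) this
  intro t ht y ξ l
  rcases eq_or_ne t 0 with rfl | ht0
  · refine eq_of_eventuallyEq_punctured (f := fun t => F ((l • y, l ^ k • ξ), t))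
      (g := fun t => l ^ (2 * k) * G ((t, y, ξ), l))
      (hF.continuous.comp (by fun_prop)).continuousAt
      (continuous_const.mul (hG.continuous.comp (by fun_prop))).continuousAt ?_
    filter_upwards [self_mem_nhdsWithin, nhdsWithin_le_nhds
      ((continuous_abs.tendsto 0).eventually (gt_mem_nhds ht))] with t h1 h2
    exact hne t h2 h1 y ξ l
  · exact hne t ht ht0 y ξ l

/-- In polar coordinates the phase is `-t` times a quadratic function of `q` with smooth
coefficients. -/
theorem SolvesCentered.exists_quadratic_form (h : SolvesCentered Ψ v τ ρ)
    (hv : HasLeadingPart v v2k k) : ∃ α β γ : ℝ × ℝ × E × ℝ × E → ℝ,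
      ContDiff ℝ ∞ α ∧ ContDiff ℝ ∞ β ∧ ContDiff ℝ ∞ γ ∧
      (∀ t, |t| < τ → ∀ (r q : ℝ) (θ η : E), Ψ (t, r • θ, q • η) =
        -t * (γ (t, r, θ, q, η) * q ^ 2 + r ^ k * β (t, r, θ, q, η) * q
          - r ^ (2 * k) * α (t, r, θ, q, η))) ∧
      ∀ t, |t| < τ → ∀ θ η : E, γ (t, 0, θ, 0, η) = ‖η‖ ^ 2 ∧ α (t, 0, θ, 0, η) = -v2k θ := by
  have hk := hv.two_le
  have hk0 : k ≠ 0 := by omega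
  obtain ⟨F, G, hF, hG, hΨF, hFG, hG0⟩ := h.exists_time_quotient hv
  obtain ⟨F₁, hF₁, h₁⟩ := exists_hadamard_quotient
    (f := fun z : (ℝ × ℝ × E × E) × ℝ => F (z.1.1, z.1.2.1 • z.1.2.2.1, z.2 • z.1.2.2.2))
    (hF.comp (by fun_prop))
  obtain ⟨F₂, hF₂, h₂⟩ := exists_hadamard_quotient hF₁
  obtain ⟨G₁, hG₁, h₃⟩ := exists_hadamard_quotient
    (f := fun z : (ℝ × ℝ × E × E) × ℝ => G ((z.1.1, z.1.2.2.1, z.2 • z.1.2.2.2), z.1.2.1))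
    (hG.comp (by fun_prop))
  simp only [smul_eq_mul, zero_smul] at h₁ h₂ h₃
  have hA : ∀ t, |t| < τ → ∀ (r : ℝ) (θ : E),
      F (t, r • θ, 0) = r ^ (2 * k) * G ((t, θ, 0), r) := fun t ht r θ => by
    simpa using hFG t ht θ 0 r
  -- Setting q = r^k s identifies the q-expansion of F with the s-expansion of G; cancelling the
  -- constant terms and r^k s compares the first quotients.
  have hFG₁ : ∀ t, |t| < τ → ∀ (r s : ℝ) (θ η : E), r ≠ 0 → s ≠ 0 →
      F₁ ((t, r, θ, η), r ^ k * s) = r ^ k * G₁ ((t, r, θ, η), s) := by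
    intro t ht r s θ η hr hs
    have e1 := h₁ (t, r, θ, η) (r ^ k * s)
    have e2 := h₃ (t, r, θ, η) s
    have e3 := hFG t ht θ (s • η) r
    simp only at e1 e2
    rw [smul_smul, e2] at e3
    rw [e3, hA t ht] at e1
    have : r ^ k * s ≠ 0 := mul_ne_zero (pow_ne_zero _ hr) hs
    refine mul_left_cancel₀ this ?_
    linear_combination -e1
  have hB' : ∀ t, |t| < τ → ∀ (r : ℝ) (θ η : E), r ≠ 0 →
      F₁ ((t, r, θ, η), 0) = r ^ k * G₁ ((t, r, θ, η), 0) := by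
    intro t ht r θ η hr
    have := eq_of_eventuallyEq_punctured (a := 0) (f := fun s => F₁ ((t, r, θ, η), r ^ k * s))
      (g := fun s => r ^ k * G₁ ((t, r, θ, η), s))
      (hF₁.continuous.comp (by fun_prop)).continuousAt
      (continuous_const.mul (hG₁.continuous.comp (by fun_prop))).continuousAt ?_
    · simpa using this
    · filter_upwards [self_mem_nhdsWithin] with s hs using hFG₁ t ht r s θ η hr hs
  have hB : ∀ t, |t| < τ → ∀ (r : ℝ) (θ η : E),
      F₁ ((t, r, θ, η), 0) = r ^ k * G₁ ((t, r, θ, η), 0) := by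
    intro t ht r θ η
    rcases eq_or_ne r 0 with rfl | hr
    · refine eq_of_eventuallyEq_punctured (a := 0) (f := fun r => F₁ ((t, r, θ, η), 0))
        (g := fun r => r ^ k * G₁ ((t, r, θ, η), 0))
        (hF₁.continuous.comp (by fun_prop)).continuousAt
        ((continuous_pow k).mul (hG₁.continuous.comp (by fun_prop))).continuousAt ?_
      filter_upwards [self_mem_nhdsWithin] with r hr using hB' t ht r θ η hr
    · exact hB' t ht r θ η hr
  -- Dividing the expansion of F₁ by r^k and letting r → 0 shows that G₁ is affine in s there, with
  -- slope F₂, the value of γ on the exceptional set.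
  have hC : ∀ t, |t| < τ → ∀ (θ η : E) (s : ℝ), s ≠ 0 →
      G₁ ((t, 0, θ, η), s) = G₁ ((t, 0, θ, η), 0) + s * F₂ ((t, 0, θ, η), 0) := by
    intro t ht θ η s hs
    have := eq_of_eventuallyEq_punctured (a := 0) (f := fun r => G₁ ((t, r, θ, η), s))
        (g := fun r => G₁ ((t, r, θ, η), 0) + s * F₂ ((t, r, θ, η), r ^ k * s))
        (hG₁.continuous.comp (by fun_prop)).continuousAt
        ((hG₁.continuous.comp (by fun_prop)).add
          (continuous_const.mul (hF₂.continuous.comp (by fun_prop)))).continuousAt ?_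
    · simpa [hk0] using this
    · filter_upwards [self_mem_nhdsWithin] with r hr
      have e1 := h₂ (t, r, θ, η) (r ^ k * s)
      rw [hFG₁ t ht r s θ η hr hs, hB t ht] at e1
      refine mul_left_cancel₀ (pow_ne_zero k hr) ?_
      linear_combination e1
  refine ⟨fun u => -G ((u.1, u.2.2.1, 0), u.2.1),
    fun u => G₁ ((u.1, u.2.1, u.2.2.1, u.2.2.2.2), 0),
    fun u => F₂ ((u.1, u.2.1, u.2.2.1, u.2.2.2.2), u.2.2.2.1),
    (hG.comp (by fun_prop)).neg, hG₁.comp (by fun_prop), hF₂.comp (by fun_prop), ?_, ?_⟩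
  · intro t ht r q θ η
    have e1 := h₁ (t, r, θ, η) q
    simp only at e1
    rw [hΨF, e1, h₂, hB t ht, hA t ht]
    ring
  · intro t ht θ η
    refine ⟨?_, by simp [hG0 t ht]⟩
    -- Adding the identities for s = 1 and s = -1 removes the linear term and isolates F₂ = ‖η‖².
    have e1 := h₃ (t, 0, θ, η) 1
    have e2 := h₃ (t, 0, θ, η) (-1)
    simp only [hG0 t ht, hC t ht θ η 1 one_ne_zero, hC t ht θ η (-1) (by norm_num), norm_smul,
      norm_zero] at e1 e2
    simp only [norm_neg, norm_one, one_mul] at e1 e2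
    simp only
    linarith

end QuadraticForm

/-! ### Completing the square and inverting along a compact set. -/

/-- The inverse function theorem along a compact set on which the map is injective. -/
theorem exists_openPartialHomeomorph_of_injOn_isCompact {X Y : Type*} [NormedAddCommGroup X]
    [NormedSpace ℝ X] [CompleteSpace X] [NormedAddCommGroup Y] [NormedSpace ℝ Y]
    {Φ : X → Y} {K O : Set X} (hK : IsCompact K) (hO : IsOpen O) (hKO : K ⊆ O)
    (hΦ : ContDiffOn ℝ ∞ Φ O) (hinj : InjOn Φ K)
    (hder : ∀ x ∈ K, ∃ L : X ≃L[ℝ] Y, HasFDerivAt Φ (L : X →L[ℝ] Y) x) :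
    ∃ e : OpenPartialHomeomorph X Y, (∀ x, e x = Φ x) ∧ K ⊆ e.source ∧ e.source ⊆ O ∧
      ContDiffOn ℝ ∞ e.symm e.target := by
  have hat : ∀ x ∈ O, ContDiffAt ℝ ∞ Φ x := fun x hx => hΦ.contDiffAt (hO.mem_nhds hx)
  set O' := O ∩ fderiv ℝ Φ ⁻¹' range ((↑) : (X ≃L[ℝ] Y) → X →L[ℝ] Y) with hO'
  have hO'open : IsOpen O' :=
    (hΦ.continuousOn_fderiv_of_isOpen hO (by simp)).isOpen_inter_preimage hO
      ContinuousLinearEquiv.isOpen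
  have hKO' : K ⊆ O' := fun x hx => ⟨hKO hx, by
    obtain ⟨L, hL⟩ := hder x hx
    exact ⟨L, hL.fderiv.symm⟩⟩
  have hstrict : ∀ x ∈ O', ∃ L : X ≃L[ℝ] Y, HasStrictFDerivAt Φ (L : X →L[ℝ] Y) x := by
    rintro x ⟨hx, L, hL⟩
    exact ⟨L, hL ▸ (hat x hx).hasStrictFDerivAt (by simp)⟩
  -- Injectivity on the compact K together with local injectivity at its points gives injectivity on
  -- a neighbourhood of K.
  obtain ⟨s, hs, hsinj⟩ := hinj.exists_mem_nhdsSet hK (fun x hx => (hat x (hKO hx)).continuousAt)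
    (fun x hx => by
      obtain ⟨L, hL⟩ := hstrict x (hKO' hx)
      exact ⟨_, (hL.toOpenPartialHomeomorph Φ).open_source.mem_nhds
        hL.mem_toOpenPartialHomeomorph_source, (hL.toOpenPartialHomeomorph Φ).injOn⟩)
  set U := O' ∩ interior s with hU
  have hUopen : IsOpen U := hO'open.inter isOpen_interior
  have hUinj : InjOn Φ U := hsinj.mono (inter_subset_right.trans interior_subset)
  have hopen : IsOpenMap ((hUinj.toPartialEquiv).source.domRestrict hUinj.toPartialEquiv) := by
    refine isOpenMap_iff_nhds_le.2 fun x => ?_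
    obtain ⟨L, hL⟩ := hstrict x x.2.1
    change 𝓝 (Φ x) ≤ map (Φ ∘ Subtype.val) (𝓝 x)
    rw [← Filter.map_map, ← hL.map_nhds_eq_of_equiv]
    exact (map_mono (hUopen.isOpenEmbedding_subtypeVal.map_nhds_eq x).ge)
  refine ⟨OpenPartialHomeomorph.ofContinuousOpenRestrict hUinj.toPartialEquiv
    (hΦ.continuousOn.mono (inter_subset_left.trans inter_subset_left)) hopen hUopen,
    fun x => rfl, subset_inter hKO' (subset_interior_iff_mem_nhdsSet.2 hs),
    inter_subset_left.trans inter_subset_left, ?_⟩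
  intro y hy
  set e := OpenPartialHomeomorph.ofContinuousOpenRestrict hUinj.toPartialEquiv
    (hΦ.continuousOn.mono (inter_subset_left.trans inter_subset_left)) hopen hUopen
  have hmem : e.symm y ∈ U := e.map_target hy
  obtain ⟨L, hL⟩ := hstrict _ hmem.1
  exact (e.contDiffAt_symm hy hL.hasFDerivAt (hat _ hmem.1.1)).contDiffWithinAt

/-- The linear change of coordinates
`(t, r, θ, q, η) ↦ (t, a q + b r, c r, θ, η)`, with `a, c ≠ 0`. -/
noncomputable def polarLinearEquiv (E : Type) [NormedAddCommGroup E] [NormedSpace ℝ E]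
    [FiniteDimensional ℝ E] (a b c : ℝ) (ha : a ≠ 0) (hc : c ≠ 0) :
    (ℝ × ℝ × E × ℝ × E) ≃L[ℝ] (ℝ × ℝ × ℝ × E × E) :=
  LinearEquiv.toContinuousLinearEquiv
    { toFun := fun u => (u.1, a * u.2.2.2.1 + b * u.2.1, c * u.2.1, u.2.2.1, u.2.2.2.2)
      map_add' := fun u w => by simp; constructor <;> ring
      map_smul' := fun s u => by simp; constructor <;> ring
      invFun := fun w => (w.1, w.2.2.1 / c, w.2.2.2.1, (w.2.1 - b * (w.2.2.1 / c)) / a, w.2.2.2.2)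
      left_inv := fun u => by simp [ha, hc]
      right_inv := fun w => by
        have : a * ((w.2.1 - b * (w.2.2.1 / c)) / a) + b * (w.2.2.1 / c) = w.2.1 := by
          field_simp; ring
        simp [this, mul_div_cancel₀ _ hc] }

/-- Completing the square in `γ q² + r ^ k β q - r ^ (2k) α` yields local coordinates near the
part `r = q = 0`, `‖θ‖ = ‖η‖ = 1` of the exceptional set. -/
theorem exists_square_coordinates {E : Type} [NormedAddCommGroup E] [NormedSpace ℝ E]
    [FiniteDimensional ℝ E] {α β γ : ℝ × ℝ × E × ℝ × E → ℝ} (hα : ContDiff ℝ ∞ α)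
    (hβ : ContDiff ℝ ∞ β) (hγ : ContDiff ℝ ∞ γ) {k : ℕ} (hk : k ≠ 0) {T : ℝ}
    {O : Set (ℝ × ℝ × E × ℝ × E)} (hO : IsOpen O)
    (hK : ∀ t ∈ Icc (-T) T, ∀ θ η : E, ‖θ‖ = 1 → ‖η‖ = 1 →
      (t, (0 : ℝ), θ, (0 : ℝ), η) ∈ O ∧ 0 < γ (t, 0, θ, 0, η) ∧ 0 < α (t, 0, θ, 0, η)) :
    ∃ e : OpenPartialHomeomorph (ℝ × ℝ × E × ℝ × E) (ℝ × ℝ × ℝ × E × E),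
      ContDiffOn ℝ ∞ e e.source ∧ ContDiffOn ℝ ∞ e.symm e.target ∧
      (∀ t ∈ Icc (-T) T, ∀ θ η : E, ‖θ‖ = 1 → ‖η‖ = 1 →
        (t, (0 : ℝ), θ, (0 : ℝ), η) ∈ e.source) ∧ e.source ⊆ O ∧
      ∀ (t r q : ℝ) (θ η : E), (t, r, θ, q, η) ∈ e.source →
        ∃ χ₁ χ₂ : ℝ, e (t, r, θ, q, η) = (t, χ₁, χ₂, θ, η) ∧
          SignType.sign χ₂ = SignType.sign r ∧
          (r = 0 → SignType.sign χ₁ = SignType.sign q) ∧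
          γ (t, r, θ, q, η) * q ^ 2 + r ^ k * β (t, r, θ, q, η) * q
            - r ^ (2 * k) * α (t, r, θ, q, η) = χ₁ ^ 2 - χ₂ ^ (2 * k) := by
  obtain ⟨j, rfl⟩ := Nat.exists_eq_succ_of_ne_zero hk
  set a : ℝ × ℝ × E × ℝ × E → ℝ := fun u => √(γ u) with ha
  -- With k = j + 1, the square is (a q + b r)² - (c r)^(2k): b r is half the cross term divided by
  -- a = √γ, and c^(2k) = ρ collects α and the completed square.
  set b : ℝ × ℝ × E × ℝ × E → ℝ := fun u => u.2.1 ^ j * β u / (2 * √(γ u)) with hb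
  set ρ : ℝ × ℝ × E × ℝ × E → ℝ := fun u => α u + β u ^ 2 / (4 * γ u) with hρ
  set c : ℝ × ℝ × E × ℝ × E → ℝ := fun u => ρ u ^ ((2 * (j + 1) : ℕ) : ℝ)⁻¹ with hc
  -- The last condition is ρ > 0 multiplied by 4γ, a form without division that is visibly open.
  set O' := O ∩ {u | 0 < γ u} ∩ {u | 0 < 4 * γ u * α u + β u ^ 2} with hO'
  have hO'open : IsOpen O' :=
    (hO.inter (isOpen_lt continuous_const hγ.continuous)).inter
      (isOpen_lt continuous_const
        (((continuous_const.mul hγ.continuous).mul hα.continuous).add (hβ.continuous.pow 2)))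
  have hρpos : ∀ u ∈ O', 0 < ρ u := by
    rintro u ⟨⟨-, h1⟩, h2⟩
    have h1 : 0 < γ u := h1
    have h2 : 0 < 4 * γ u * α u + β u ^ 2 := h2
    have : ρ u = (4 * γ u * α u + β u ^ 2) / (4 * γ u) := by
      simp only [hρ]; field_simp
    rw [this]; positivity
  have hapos : ∀ u ∈ O', 0 < a u := fun u hu => Real.sqrt_pos.2 hu.1.2
  have hcpos : ∀ u ∈ O', 0 < c u := fun u hu => Real.rpow_pos_of_pos (hρpos u hu) _
  have has : ∀ u ∈ O', ContDiffAt ℝ ∞ a u := fun u hu =>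
    hγ.contDiffAt.sqrt (ne_of_gt hu.1.2)
  have hbs : ∀ u ∈ O', ContDiffAt ℝ ∞ b u := fun u hu =>
    ((by fun_prop : ContDiffAt ℝ ∞ (fun u : ℝ × ℝ × E × ℝ × E => u.2.1 ^ j) u).mul
      hβ.contDiffAt).div (contDiffAt_const.mul (has u hu))
      (mul_ne_zero two_ne_zero (hapos u hu).ne')
  have hcs : ∀ u ∈ O', ContDiffAt ℝ ∞ c u := fun u hu =>
    (hα.contDiffAt.add ((hβ.contDiffAt.pow 2).div (contDiffAt_const.mul hγ.contDiffAt)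
      (mul_ne_zero four_ne_zero (ne_of_gt hu.1.2)))).rpow_const_of_ne (hρpos u hu).ne'
  set Φ : ℝ × ℝ × E × ℝ × E → ℝ × ℝ × ℝ × E × E := fun u =>
    (u.1, a u * u.2.2.2.1 + b u * u.2.1, c u * u.2.1, u.2.2.1, u.2.2.2.2) with hΦ
  have hΦs : ContDiffOn ℝ ∞ Φ O' := fun u hu => by
    have h1 := has u hu
    have h2 := hbs u hu
    have h3 := hcs u hu
    exact (by fun_prop : ContDiffAt ℝ ∞ Φ u).contDiffWithinAt
  set K : Set (ℝ × ℝ × E × ℝ × E) :=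
    Icc (-T) T ×ˢ {0} ×ˢ Metric.sphere 0 1 ×ˢ {0} ×ˢ Metric.sphere 0 1 with hKdef
  have hKc : IsCompact K := isCompact_Icc.prod (isCompact_singleton.prod
    ((isCompact_sphere 0 1).prod (isCompact_singleton.prod (isCompact_sphere 0 1))))
  have hKO' : K ⊆ O' := by
    rintro ⟨t, r, θ, q, η⟩ ⟨ht, hr, hθ, hq, hη⟩
    obtain rfl : r = 0 := hr
    obtain rfl : q = 0 := hq
    obtain ⟨h1, h2, h3⟩ := hK t ht θ η (by simpa using hθ) (by simpa using hη)
    exact ⟨⟨h1, h2⟩, by change 0 < 4 * γ _ * α _ + β _ ^ 2; positivity⟩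
  have hKinj : InjOn Φ K := by
    rintro ⟨t, r, θ, q, η⟩ ⟨ht, hr, hθ, hq, hη⟩ ⟨t', r', θ', q', η'⟩ ⟨ht', hr', hθ', hq', hη'⟩ h
    obtain rfl : r = 0 := hr
    obtain rfl : q = 0 := hq
    obtain rfl : r' = 0 := hr'
    obtain rfl : q' = 0 := hq'
    simpa [hΦ] using h
  have hKder : ∀ u ∈ K, ∃ L : (ℝ × ℝ × E × ℝ × E) ≃L[ℝ] (ℝ × ℝ × ℝ × E × E),
      HasFDerivAt Φ (L : (ℝ × ℝ × E × ℝ × E) →L[ℝ] (ℝ × ℝ × ℝ × E × E)) u := by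
    intro u hu
    have hr : u.2.1 = 0 := hu.2.1
    have hq : u.2.2.2.1 = 0 := hu.2.2.2.1
    have huO := hKO' hu
    refine ⟨polarLinearEquiv E (a u) (b u) (c u) (hapos u huO).ne' (hcpos u huO).ne', ?_⟩
    have d0 : HasFDerivAt (fun u : ℝ × ℝ × E × ℝ × E => u) (ContinuousLinearMap.id ℝ _) u :=
      hasFDerivAt_id u
    have da := ((has u huO).differentiableAt (by simp)).hasFDerivAt
    have db := ((hbs u huO).differentiableAt (by simp)).hasFDerivAt
    have dc := ((hcs u huO).differentiableAt (by simp)).hasFDerivAt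
    have d := d0.fst.prodMk (((da.mul d0.snd.snd.snd.fst).add (db.mul d0.snd.fst)).prodMk
      ((dc.mul d0.snd.fst).prodMk (d0.snd.snd.fst.prodMk d0.snd.snd.snd.snd)))
    -- At r = q = 0 the derivatives of a, b and c are multiplied by zero, leaving the linear map
    -- with a, b, c frozen.
    refine d.congr_fderiv ?_
    refine ContinuousLinearMap.ext fun w => ?_
    simp [hr, hq, polarLinearEquiv]
  obtain ⟨e, heΦ, hKe, heO, hes⟩ :=
    exists_openPartialHomeomorph_of_injOn_isCompact hKc hO'open hKO' hΦs hKinj hKder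
  refine ⟨e, (hΦs.mono heO).congr fun u _ => heΦ u, hes, fun t ht θ η hθ hη =>
    hKe ⟨ht, rfl, by simpa using hθ, rfl, by simpa using hη⟩,
    heO.trans (inter_subset_left.trans inter_subset_left), fun t r q θ η hu => ?_⟩
  have huO := heO hu
  refine ⟨_, _, heΦ _, ?_, ?_, ?_⟩
  · simp only
    rw [sign_mul, sign_pos (hcpos _ huO), one_mul]
  · rintro rfl
    simp only
    rw [mul_zero, add_zero, sign_mul, sign_pos (hapos _ huO), one_mul]
  · set u : ℝ × ℝ × E × ℝ × E := (t, r, θ, q, η) with hu'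
    have hγu : 0 < γ u := huO.1.2
    have h1 : c u ^ (2 * (j + 1)) = ρ u := by
      simp only [hc]
      exact Real.rpow_inv_natCast_pow (hρpos u huO).le (by omega)
    have h2 : a u ^ 2 = γ u := Real.sq_sqrt hγu.le
    have h3 : a u * b u = r ^ j * β u / 2 := by
      have := (hapos u huO).ne'
      simp only [hb, ha] at this ⊢
      field_simp
      simp only [hu']
      ring
    have h4 : b u ^ 2 = r ^ (2 * j) * (β u ^ 2 / (4 * γ u)) := by
      simp only [hb]
      rw [div_pow, mul_pow, mul_pow, Real.sq_sqrt hγu.le]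
      simp only [hu']
      field_simp
      ring
    change _ = (a u * q + b u * r) ^ 2 - (c u * r) ^ (2 * (j + 1))
    rw [mul_pow, h1]
    simp only [hρ, Nat.succ_eq_add_one]
    linear_combination (-q ^ 2) * h2 - 2 * q * r * h3 - r ^ 2 * h4

/-! ### Reduction to a centred, globally smooth problem. -/

theorem HasDegenerateMaximum.hasLeadingPart {d k : ℕ} {V V2k : Conf d → ℝ} {Ec : ℝ}
    {x₀ : Conf d} (hV : ContDiff ℝ ∞ V) (hmax : HasDegenerateMaximum V Ec x₀ k V2k) :
    HasLeadingPart (fun y => V (x₀ + y) - Ec) V2k k := by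
  have hk := hmax.two_le
  have hV0 : V2k 0 = 0 := by
    have := hmax.homogeneous 0 0
    simpa [zero_pow (by omega : 2 * k ≠ 0)] using this
  -- The bound also holds at x₀ itself, where its right side is zero.
  have hx₀ : V x₀ - Ec = 0 := by
    obtain ⟨C, hC⟩ := hmax.expansion.bound
    have := hC.self_of_nhds
    simpa [hV0] using this
  have htend : ∀ y, Tendsto (fun l : ℝ => (V (x₀ + l • y) - Ec) / l ^ (2 * k)) (𝓝[≠] 0)
      (𝓝 (V2k y)) := by
    intro y
    have hl : Tendsto (fun l : ℝ => x₀ + l • y) (𝓝[≠] 0) (𝓝 x₀) := by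
      have := (by fun_prop : Continuous fun l : ℝ => x₀ + l • y).tendsto 0
      simpa using this.mono_left nhdsWithin_le_nhds
    obtain ⟨C, hC⟩ := hmax.expansion.bound
    have hlim0 : Tendsto (fun l : ℝ => C * (|l| * ‖y‖ ^ (2 * k + 1))) (𝓝[≠] 0) (𝓝 0) := by
      have := (by fun_prop : Continuous fun l : ℝ => C * (|l| * ‖y‖ ^ (2 * k + 1))).tendsto 0
      simpa using this.mono_left nhdsWithin_le_nhds
    refine tendsto_iff_norm_sub_tendsto_zero.2 (squeeze_zero' (Eventually.of_forall fun _ =>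
      norm_nonneg _) ?_ hlim0)
    filter_upwards [hl.eventually hC, self_mem_nhdsWithin] with l h1 h2
    have h2 : l ≠ 0 := h2
    have h3 : (V (x₀ + l • y) - Ec) / l ^ (2 * k) - V2k y
        = (V (x₀ + l • y) - (Ec + V2k (l • y))) / l ^ (2 * k) := by
      rw [hmax.homogeneous]; field_simp; ring
    rw [h3, norm_div, norm_pow, div_le_iff₀ (by positivity)]
    simp only [add_sub_cancel_left, norm_smul, norm_pow, norm_mul, norm_norm] at h1
    refine h1.trans_eq ?_
    rw [Real.norm_eq_abs, mul_pow, pow_succ |l|]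
    ring
  refine ⟨hk, by simpa using hx₀, ?_, htend⟩
  have hd : HasFDerivAt (fun y => V (x₀ + y) - Ec) (fderiv ℝ V x₀) 0 := by
    have h1 : HasFDerivAt V (fderiv ℝ V x₀) (x₀ + 0) := by
      rw [add_zero]; exact (hV.differentiable (by simp) x₀).hasFDerivAt
    have h2 : HasFDerivAt (fun y : Conf d => x₀ + y) (ContinuousLinearMap.id ℝ (Conf d)) 0 :=
      (hasFDerivAt_id (0 : Conf d)).const_add x₀
    exact (HasFDerivAt.comp (g := V) (f := fun y : Conf d => x₀ + y) 0 h1 h2).sub_const Ec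
  suffices hz : fderiv ℝ V x₀ = 0 by rwa [hz] at hd
  refine ContinuousLinearMap.ext fun y => ?_
  have h1 : HasDerivAt (fun l : ℝ => V (x₀ + l • y) - Ec) (fderiv ℝ V x₀ y) 0 := by
    have e1 : HasDerivAt (fun l : ℝ => l • y) y 0 := by
      simpa using (hasDerivAt_id (0 : ℝ)).smul_const y
    exact HasFDerivAt.comp_hasDerivAt_of_eq (0 : ℝ) hd e1 (by simp)
  have h2 := h1.tendsto_slope_zero
  -- The difference quotient along y is l^(2k-1) times a convergent quantity, so every directional
  -- derivative at x₀ vanishes.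
  have h3 : Tendsto (fun l : ℝ => l ^ (2 * k - 1) * ((V (x₀ + l • y) - Ec) / l ^ (2 * k)))
      (𝓝[≠] 0) (𝓝 (0 * V2k y)) := by
    refine Tendsto.mul ?_ (htend y)
    have := ((continuous_pow (2 * k - 1)).tendsto (0 : ℝ)).mono_left
      (nhdsWithin_le_nhds (s := {0}ᶜ))
    rwa [zero_pow (by omega : 2 * k - 1 ≠ 0)] at this
  rw [zero_mul] at h3
  refine tendsto_nhds_unique h2 (h3.congr' ?_)
  filter_upwards [self_mem_nhdsWithin] with l hl
  have hl : l ≠ 0 := hl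
  obtain ⟨j, hj⟩ := Nat.exists_eq_add_of_le (show 1 ≤ 2 * k by omega)
  rw [hj, show 1 + j - 1 = j by omega, pow_add]
  simp only [zero_add, zero_smul, add_zero, hx₀, sub_zero, smul_eq_mul]
  field_simp

theorem exists_box_subset {d : ℕ} {W : Set (ℝ × Conf d × Conf d)} (hWo : IsOpen W) (x₀ : Conf d)
    {T : ℝ} (hT : 0 < T) (hW : ∀ t ∈ Icc (-T) T, (t, x₀, (0 : Conf d)) ∈ W) :
    ∃ δ > 0, ∀ (t : ℝ) (y ξ : Conf d), |t| ≤ T + δ → ‖y‖ ≤ δ → ‖ξ‖ ≤ δ →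
      (t, x₀ + y, ξ) ∈ W := by
  have hc : IsCompact (Icc (-T) T ×ˢ {(x₀, (0 : Conf d))}) := isCompact_Icc.prod isCompact_singleton
  obtain ⟨δ, hδ, h⟩ := hc.exists_cthickening_subset_open hWo (by
    rintro ⟨t, z⟩ ⟨ht, hz⟩
    obtain rfl : z = (x₀, 0) := hz
    exact hW t ht)
  refine ⟨δ, hδ, fun t y ξ ht hy hξ => h ?_⟩
  -- The comparison point in [-T, T] is t clamped to that interval.
  refine Metric.mem_cthickening_of_dist_le _ (max (-T) (min t T), x₀, 0) _ _ ⟨?_, rfl⟩ ?_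
  · exact ⟨le_max_left _ _, max_le (by linarith) (min_le_right _ _)⟩
  · rw [abs_le] at ht
    refine max_le ?_ (max_le (by simpa using hy) (by simpa using hξ))
    rw [Real.dist_eq, abs_le]
    rcases max_cases (-T) (min t T) with h1 | h1 <;> rcases min_cases t T with h2 | h2 <;>
      constructor <;> simp only <;> linarith [h1.1, h1.2, h2.1, h2.2]

section Cutoff

variable {d : ℕ} {V : Conf d → ℝ} {W : Set (ℝ × Conf d × Conf d)} {S : ℝ → Conf d → Conf d → ℝ}

/-- Here ∂ₓS = ∇Ψ + ξ and ∂ₜS = ∂ₜΨ - Ec. Only the germ of Ψ matters, so a cut-off phase qualifies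
wherever the cutoff is locally 1. -/
theorem SolvesHamiltonJacobi.centered_equation (hS : SolvesHamiltonJacobi V W S)
    {x₀ : Conf d} {Ec : ℝ} {Ψ : ℝ × Conf d × Conf d → ℝ} {t : ℝ} {y ξ : Conf d}
    (hw : (t, x₀ + y, ξ) ∈ W)
    (hΨ : Ψ =ᶠ[𝓝 (t, y, ξ)] fun z => phase S Ec z.1 (x₀ + z.2.1) z.2.2) :
    fderiv ℝ Ψ (t, y, ξ) (1, 0, 0)
      + ‖partialGradient (positionIncl (Conf d)) Ψ (t, y, ξ) + ξ‖ ^ 2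
      + (V (x₀ + y) - Ec) = 0 := by
  set S' : ℝ × Conf d × Conf d → ℝ := fun w => S w.1 w.2.1 w.2.2 with hS'
  have hSd : HasFDerivAt S' (fderiv ℝ S' (t, x₀ + y, ξ)) (t, x₀ + y, ξ) :=
    ((hS.smooth.contDiffAt (hS.isOpen.mem_nhds hw)).differentiableAt (by simp)).hasFDerivAt
  have d0 : HasFDerivAt (fun z : ℝ × Conf d × Conf d => z) (ContinuousLinearMap.id ℝ _)
    (t, y, ξ) := hasFDerivAt_id _
  have dtr : HasFDerivAt (fun z : ℝ × Conf d × Conf d => (z.1, x₀ + z.2.1, z.2.2))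
      (ContinuousLinearMap.id ℝ _) (t, y, ξ) :=
    d0.fst.prodMk ((d0.snd.fst.const_add x₀).prodMk d0.snd.snd)
  have dΨ := ((((HasFDerivAt.comp (g := S') (t, y, ξ) hSd dtr).sub
    ((d0.snd.fst.const_add x₀).inner ℝ d0.snd.snd)).add
      (d0.fst.mul_const Ec)).congr_of_eventuallyEq hΨ).fderiv
  have htime : deriv (fun s => S s (x₀ + y) ξ) t = fderiv ℝ S' (t, x₀ + y, ξ) (1, 0, 0) :=
    (HasFDerivAt.comp_hasDerivAt (l := S') t hSd
      ((hasDerivAt_id t).prodMk (hasDerivAt_const t (x₀ + y, ξ)))).deriv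
  have hspace : gradient (fun x => S t x ξ) (x₀ + y)
      = partialGradient (positionIncl (Conf d)) Ψ (t, y, ξ) + ξ := by
    have e : HasFDerivAt (fun x => S t x ξ)
        ((fderiv ℝ S' (t, x₀ + y, ξ)).comp (positionIncl (Conf d))) (x₀ + y) :=
      HasFDerivAt.comp (g := S') (x₀ + y) hSd
        (f := fun x => (t, x, ξ)) (f' := positionIncl (Conf d))
        (((hasFDerivAt_const t (x₀ + y)).prodMk
          ((hasFDerivAt_id (x₀ + y)).prodMk (hasFDerivAt_const ξ (x₀ + y)))).congr_fderiv
            (ContinuousLinearMap.ext fun v => by simp))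
    refine ext_inner_right ℝ fun v => ?_
    rw [inner_add_left, inner_partialGradient, dΨ, gradient, e.fderiv]
    simp [real_inner_comm]
  have heq := hS.equation t (x₀ + y) ξ hw
  rw [htime, hspace, symbol] at heq
  have : fderiv ℝ Ψ (t, y, ξ) (1, 0, 0) = fderiv ℝ S' (t, x₀ + y, ξ) (1, 0, 0) + Ec := by
    rw [dΨ]; simp
  linarith

/-- Cutting off the phase outside a neighbourhood of `[-T, T] × {(x₀, 0)}`. -/
theorem SolvesHamiltonJacobi.exists_solvesCentered (hS : SolvesHamiltonJacobi V W S)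
    (x₀ : Conf d) (Ec : ℝ) {T : ℝ} (hT : 0 < T)
    (hW : ∀ t ∈ Icc (-T) T, (t, x₀, (0 : Conf d)) ∈ W) :
    ∃ (Ψ : ℝ × Conf d × Conf d → ℝ) (τ ρ : ℝ), T < τ ∧
      SolvesCentered Ψ (fun y => V (x₀ + y) - Ec) τ ρ ∧
      ∀ (t : ℝ) (y ξ : Conf d), |t| < τ → ‖y‖ < ρ → ‖ξ‖ < ρ →
        (t, x₀ + y, ξ) ∈ W ∧ phase S Ec t (x₀ + y) ξ = Ψ (t, y, ξ) := by
  obtain ⟨δ, hδ, hbox⟩ := exists_box_subset hS.isOpen x₀ hT hW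
  let b₁ : ContDiffBump (0 : ℝ) := ⟨T + δ / 2, T + δ, by linarith, by linarith⟩
  let b₂ : ContDiffBump (0 : Conf d) := ⟨δ / 2, δ, by linarith, by linarith⟩
  set P : ℝ × Conf d × Conf d → ℝ := fun z => phase S Ec z.1 (x₀ + z.2.1) z.2.2 with hP
  set κ : ℝ × Conf d × Conf d → ℝ := fun z => b₁ z.1 * (b₂ z.2.1 * b₂ z.2.2) with hκ
  have hκs : ContDiff ℝ ∞ κ :=
    (b₁.contDiff.comp contDiff_fst).mul
      ((b₂.contDiff.comp (contDiff_fst.comp contDiff_snd)).mul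
        (b₂.contDiff.comp (contDiff_snd.comp contDiff_snd)))
  have hone : ∀ (t : ℝ) (y ξ : Conf d), |t| < T + δ / 2 → ‖y‖ < δ / 2 → ‖ξ‖ < δ / 2 →
      κ (t, y, ξ) = 1 := by
    intro t y ξ ht hy hξ
    have h1 : b₁ t = 1 := b₁.one_of_mem_closedBall (by simpa [b₁] using ht.le)
    have h2 : b₂ y = 1 := b₂.one_of_mem_closedBall (by simpa [b₂] using hy.le)
    have h3 : b₂ ξ = 1 := b₂.one_of_mem_closedBall (by simpa [b₂] using hξ.le)
    simp [hκ, h1, h2, h3]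
  have hzero : ∀ z : ℝ × Conf d × Conf d, ¬ (|z.1| ≤ T + δ ∧ ‖z.2.1‖ ≤ δ ∧ ‖z.2.2‖ ≤ δ) →
      κ z = 0 := by
    intro z hz
    by_contra hne
    obtain ⟨h1, h23⟩ := mul_ne_zero_iff.1 hne
    obtain ⟨h2, h3⟩ := mul_ne_zero_iff.1 h23
    refine hz ⟨?_, ?_, ?_⟩
    · by_contra! h
      exact h1 (b₁.zero_of_le_dist (by simpa [b₁] using h.le))
    · by_contra! h
      exact h2 (b₂.zero_of_le_dist (by simpa [b₂] using h.le))
    · by_contra! h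
      exact h3 (b₂.zero_of_le_dist (by simpa [b₂] using h.le))
  have hclosed : IsClosed {z : ℝ × Conf d × Conf d | |z.1| ≤ T + δ ∧ ‖z.2.1‖ ≤ δ ∧ ‖z.2.2‖ ≤ δ} :=
    (isClosed_le (f := fun z : ℝ × Conf d × Conf d => |z.1|) (by fun_prop) continuous_const).inter
      ((isClosed_le (f := fun z : ℝ × Conf d × Conf d => ‖z.2.1‖) (by fun_prop)
        continuous_const).inter
        (isClosed_le (f := fun z : ℝ × Conf d × Conf d => ‖z.2.2‖) (by fun_prop)
          continuous_const))
  -- The cutoff is 1 on the half-size box, which still reaches times beyond T, and zero outside a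
  -- box contained in W. Multiplying by it preserves the zero initial value.
  refine ⟨fun z => κ z * P z, T + δ / 2, δ / 2, by linarith,
    ⟨by linarith, by linarith, ?_, ?_, ?_⟩, ?_⟩
  · refine contDiff_iff_contDiffAt.2 fun z => ?_
    by_cases hz : |z.1| ≤ T + δ ∧ ‖z.2.1‖ ≤ δ ∧ ‖z.2.2‖ ≤ δ
    · have hw := hbox z.1 z.2.1 z.2.2 hz.1 hz.2.1 hz.2.2
      have hSs : ContDiffAt ℝ ∞ (fun z : ℝ × Conf d × Conf d => S z.1 (x₀ + z.2.1) z.2.2) z :=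
        ContDiffAt.comp z (hS.smooth.contDiffAt (hS.isOpen.mem_nhds hw))
          (by fun_prop : ContDiffAt ℝ ∞
            (fun z : ℝ × Conf d × Conf d => (z.1, x₀ + z.2.1, z.2.2)) z)
      refine hκs.contDiffAt.mul ((hSs.sub ?_).add ?_)
      · exact ContDiffAt.inner ℝ (by fun_prop) (by fun_prop)
      · fun_prop
    · have : (fun z => κ z * P z) =ᶠ[𝓝 z] fun _ => 0 := by
        filter_upwards [hclosed.isOpen_compl.mem_nhds hz] with w hw
        rw [hzero w hw, zero_mul]
      exact contDiffAt_const.congr_of_eventuallyEq this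
  · intro t y ξ ht hy hξ
    refine hS.centered_equation (hbox t y ξ (by linarith) (by linarith) (by linarith)) ?_
    have e1 : ∀ᶠ z in 𝓝 (t, y, ξ), |z.1| < T + δ / 2 :=
      (by fun_prop : Continuous fun z : ℝ × Conf d × Conf d => |z.1|).continuousAt.eventually_lt
        continuousAt_const ht
    have e2 : ∀ᶠ z in 𝓝 (t, y, ξ), ‖z.2.1‖ < δ / 2 :=
      (by fun_prop : Continuous fun z : ℝ × Conf d × Conf d => ‖z.2.1‖).continuousAt.eventually_lt
        continuousAt_const hy
    have e3 : ∀ᶠ z in 𝓝 (t, y, ξ), ‖z.2.2‖ < δ / 2 :=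
      (by fun_prop : Continuous fun z : ℝ × Conf d × Conf d => ‖z.2.2‖).continuousAt.eventually_lt
        continuousAt_const hξ
    filter_upwards [e1, e2, e3] with z h1 h2 h3
    rw [show κ z = 1 from hone z.1 z.2.1 z.2.2 h1 h2 h3, one_mul]
  · intro y ξ
    by_cases hz : |(0 : ℝ)| ≤ T + δ ∧ ‖y‖ ≤ δ ∧ ‖ξ‖ ≤ δ
    · simp [hP, phase, hS.initial _ _ (hbox 0 y ξ hz.1 hz.2.1 hz.2.2)]
    · rw [hzero (0, y, ξ) hz, zero_mul]
  · intro t y ξ ht hy hξ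
    refine ⟨hbox t y ξ (by linarith) (by linarith) (by linarith), ?_⟩
    simp only [hone t y ξ ht hy hξ, one_mul, hP]

end Cutoff

/-! ### Restriction of the coordinates to the spheres. -/

/-- The inclusion of the blown-up space in the ambient vector space. -/
def blowUpIncl {d : ℕ} (u : BlowUp d) : ℝ × ℝ × Conf d × ℝ × Conf d :=
  (u.1, u.2.1, (u.2.2.1 : Conf d), u.2.2.2.1, (u.2.2.2.2 : Conf d))

/-- The inclusion of the space of new coordinates in the ambient vector space. -/
def normalIncl {d : ℕ} (w : NormalSpace d) : ℝ × ℝ × ℝ × Conf d × Conf d :=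
  (w.1, w.2.1, w.2.2.1, (w.2.2.2.1 : Conf d), (w.2.2.2.2 : Conf d))

theorem contMDiff_coe_unitSphere {d : ℕ} :
    ContMDiff (𝓡 d) 𝓘(ℝ, Conf d) ∞ ((↑) : UnitSphere d → Conf d) :=
  haveI : Fact (Module.finrank ℝ (Conf d) = d + 1) := ⟨finrank_euclideanSpace_fin⟩
  contMDiff_coe_sphere

theorem contMDiff_blowUpIncl {d : ℕ} :
    ContMDiff (blowUpModel d) 𝓘(ℝ, ℝ × ℝ × Conf d × ℝ × Conf d) ∞ (blowUpIncl (d := d)) := by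
  have h2 : ContMDiff (blowUpModel d) _ ∞ (fun u : BlowUp d => u.2) := contMDiff_snd
  have h3 : ContMDiff (blowUpModel d) _ ∞ (fun u : BlowUp d => u.2.2) := contMDiff_snd.comp h2
  have h4 : ContMDiff (blowUpModel d) _ ∞ (fun u : BlowUp d => u.2.2.2) := contMDiff_snd.comp h3
  exact contMDiff_fst.prodMk_space ((contMDiff_fst.comp h2).prodMk_space
    ((contMDiff_coe_unitSphere.comp (contMDiff_fst.comp h3)).prodMk_space
      ((contMDiff_fst.comp h4).prodMk_space
        (contMDiff_coe_unitSphere.comp (contMDiff_snd.comp h4)))))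

theorem contMDiff_normalIncl {d : ℕ} :
    ContMDiff (normalModel d) 𝓘(ℝ, ℝ × ℝ × ℝ × Conf d × Conf d) ∞ (normalIncl (d := d)) := by
  have h2 : ContMDiff (normalModel d) _ ∞ (fun u : NormalSpace d => u.2) := contMDiff_snd
  have h3 : ContMDiff (normalModel d) _ ∞ (fun u : NormalSpace d => u.2.2) := contMDiff_snd.comp h2
  have h4 : ContMDiff (normalModel d) _ ∞ (fun u : NormalSpace d => u.2.2.2) :=
    contMDiff_snd.comp h3
  exact contMDiff_fst.prodMk_space ((contMDiff_fst.comp h2).prodMk_space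
    ((contMDiff_fst.comp h3).prodMk_space
      ((contMDiff_coe_unitSphere.comp (contMDiff_fst.comp h4)).prodMk_space
        (contMDiff_coe_unitSphere.comp (contMDiff_snd.comp h4)))))

/-- A local diffeomorphism of the ambient vector spaces which preserves `t` and the angular
variables restricts to the blown-up space. -/
theorem exists_sphere_restriction {d : ℕ}
    (e : OpenPartialHomeomorph (ℝ × ℝ × Conf d × ℝ × Conf d) (ℝ × ℝ × ℝ × Conf d × Conf d))
    (he : ContDiffOn ℝ ∞ e e.source) (hes : ContDiffOn ℝ ∞ e.symm e.target)
    (hpres : ∀ u ∈ e.source, (e u).1 = u.1 ∧ (e u).2.2.2.1 = u.2.2.1 ∧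
      (e u).2.2.2.2 = u.2.2.2.2) :
    ∃ χ : OpenPartialHomeomorph (BlowUp d) (NormalSpace d),
      ContMDiffOn (blowUpModel d) (normalModel d) ∞ χ χ.source ∧
      ContMDiffOn (normalModel d) (blowUpModel d) ∞ χ.symm χ.target ∧
      χ.source = blowUpIncl ⁻¹' e.source ∧
      ∀ u, χ u = (u.1, (e (blowUpIncl u)).2.1, (e (blowUpIncl u)).2.2.1, u.2.2.1, u.2.2.2.2) := by
  -- The angles are copied from the argument instead of being read off `e`, so they lie on the
  -- sphere by construction and depend smoothly on it.
  set f : BlowUp d → NormalSpace d := fun u =>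
    (u.1, (e (blowUpIncl u)).2.1, (e (blowUpIncl u)).2.2.1, u.2.2.1, u.2.2.2.2) with hf
  set g : NormalSpace d → BlowUp d := fun w =>
    (w.1, (e.symm (normalIncl w)).2.1, w.2.2.2.1, (e.symm (normalIncl w)).2.2.2.1, w.2.2.2.2)
    with hg
  have hfe : ∀ u, blowUpIncl u ∈ e.source → normalIncl (f u) = e (blowUpIncl u) := by
    intro u hu
    obtain ⟨h1, h2, h3⟩ := hpres _ hu
    exact Prod.ext h1.symm (Prod.ext rfl (Prod.ext rfl (Prod.ext h2.symm h3.symm)))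
  have hge : ∀ w, normalIncl w ∈ e.target → blowUpIncl (g w) = e.symm (normalIncl w) := by
    intro w hw
    obtain ⟨h1, h2, h3⟩ := hpres _ (e.map_target hw)
    rw [e.right_inv hw] at h1 h2 h3
    exact Prod.ext h1 (Prod.ext rfl (Prod.ext h2 (Prod.ext rfl h3)))
  have hfs : ContMDiffOn (blowUpModel d) (normalModel d) ∞ f (blowUpIncl ⁻¹' e.source) := by
    have h0 : ContMDiffOn (blowUpModel d) 𝓘(ℝ, ℝ × ℝ × ℝ × Conf d × Conf d) ∞
        (fun u => e (blowUpIncl u)) (blowUpIncl ⁻¹' e.source) :=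
      he.contMDiffOn.comp contMDiff_blowUpIncl.contMDiffOn (fun _ h => h)
    have h1 : ContMDiffOn (blowUpModel d) 𝓘(ℝ, ℝ) ∞
        (fun u => (e (blowUpIncl u)).2.1) (blowUpIncl ⁻¹' e.source) :=
      (contDiff_fst.comp contDiff_snd :
        ContDiff ℝ ∞ fun w : ℝ × ℝ × ℝ × Conf d × Conf d => w.2.1).contMDiff.comp_contMDiffOn h0
    have h2 : ContMDiffOn (blowUpModel d) 𝓘(ℝ, ℝ) ∞
        (fun u => (e (blowUpIncl u)).2.2.1) (blowUpIncl ⁻¹' e.source) :=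
      (contDiff_fst.comp (contDiff_snd.comp contDiff_snd) :
        ContDiff ℝ ∞ fun w : ℝ × ℝ × ℝ × Conf d × Conf d => w.2.2.1).contMDiff.comp_contMDiffOn h0
    have h3 : ContMDiff (blowUpModel d) _ ∞ (fun u : BlowUp d => u.2.2) :=
      contMDiff_snd.comp contMDiff_snd
    exact contMDiff_fst.contMDiffOn.prodMk (h1.prodMk (h2.prodMk
      ((contMDiff_fst.comp h3).contMDiffOn.prodMk
        (contMDiff_snd.comp (contMDiff_snd.comp h3)).contMDiffOn)))
  have hgs : ContMDiffOn (normalModel d) (blowUpModel d) ∞ g (normalIncl ⁻¹' e.target) := by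
    have h0 : ContMDiffOn (normalModel d) 𝓘(ℝ, ℝ × ℝ × Conf d × ℝ × Conf d) ∞
        (fun w => e.symm (normalIncl w)) (normalIncl ⁻¹' e.target) :=
      hes.contMDiffOn.comp contMDiff_normalIncl.contMDiffOn (fun _ h => h)
    have h1 : ContMDiffOn (normalModel d) 𝓘(ℝ, ℝ) ∞
        (fun w => (e.symm (normalIncl w)).2.1) (normalIncl ⁻¹' e.target) :=
      (contDiff_fst.comp contDiff_snd :
        ContDiff ℝ ∞ fun w : ℝ × ℝ × Conf d × ℝ × Conf d => w.2.1).contMDiff.comp_contMDiffOn h0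
    have h2 : ContMDiffOn (normalModel d) 𝓘(ℝ, ℝ) ∞
        (fun w => (e.symm (normalIncl w)).2.2.2.1) (normalIncl ⁻¹' e.target) :=
      (contDiff_fst.comp (contDiff_snd.comp (contDiff_snd.comp contDiff_snd)) :
        ContDiff ℝ ∞ fun w : ℝ × ℝ × Conf d × ℝ × Conf d =>
          w.2.2.2.1).contMDiff.comp_contMDiffOn h0
    have h3 : ContMDiff (normalModel d) _ ∞ (fun w : NormalSpace d => w.2.2.2) :=
      contMDiff_snd.comp (contMDiff_snd.comp contMDiff_snd)
    exact contMDiff_fst.contMDiffOn.prodMk (h1.prodMk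
      ((contMDiff_fst.comp h3).contMDiffOn.prodMk (h2.prodMk
        (contMDiff_snd.comp h3).contMDiffOn)))
  refine ⟨
    { toFun := f
      invFun := g
      source := blowUpIncl ⁻¹' e.source
      target := normalIncl ⁻¹' e.target
      map_source' := fun u hu => by
        rw [mem_preimage, hfe u hu]; exact e.map_source hu
      map_target' := fun w hw => by
        rw [mem_preimage, hge w hw]; exact e.map_target hw
      left_inv' := fun u hu => by
        simp only [hg]
        rw [hfe u hu, e.left_inv hu]
        rfl
      right_inv' := fun w hw => by
        simp only [hf]
        rw [hge w hw, e.right_inv hw]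
        rfl
      open_source := e.open_source.preimage contMDiff_blowUpIncl.continuous
      open_target := e.open_target.preimage contMDiff_normalIncl.continuous
      continuousOn_toFun := hfs.continuousOn
      continuousOn_invFun := hgs.continuousOn }, hfs, hgs, rfl, fun u => rfl⟩

end DegenerateMaximum

/-! ### Assembly of the normal form. -/

theorem mainTheorem4 (d k : ℕ) (V V2k : DegenerateMaximum.Conf d → ℝ) (Ec : ℝ)
    (x₀ : DegenerateMaximum.Conf d)
    (hV : ContDiff ℝ ∞ V)
    (hmax : DegenerateMaximum.HasDegenerateMaximum V Ec x₀ k V2k)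
    (T : ℝ) (hT : 0 < T)
    (W : Set (ℝ × DegenerateMaximum.Conf d × DegenerateMaximum.Conf d))
    (S : ℝ → DegenerateMaximum.Conf d → DegenerateMaximum.Conf d → ℝ)
    (hS : DegenerateMaximum.SolvesHamiltonJacobi V W S)
    (hW : ∀ t ∈ Icc (-T) T, (t, x₀, (0 : DegenerateMaximum.Conf d)) ∈ W) :
    ∃ χ : OpenPartialHomeomorph (DegenerateMaximum.BlowUp d) (DegenerateMaximum.NormalSpace d),
      -- `χ` is a diffeomorphism between open subsets
      ContMDiffOn (DegenerateMaximum.blowUpModel d) (DegenerateMaximum.normalModel d) ∞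
        χ χ.source ∧
      ContMDiffOn (DegenerateMaximum.normalModel d) (DegenerateMaximum.blowUpModel d) ∞
        χ.symm χ.target ∧
      -- whose domain contains the exceptional set and lies over the domain of `S`
      (∀ t ∈ Icc (-T) T, ∀ θ η : DegenerateMaximum.UnitSphere d,
        (t, (0 : ℝ), θ, (0 : ℝ), η) ∈ χ.source) ∧
      (∀ u ∈ χ.source, DegenerateMaximum.blowDown x₀ u ∈ W) ∧
      ∀ (t r q : ℝ) (θ η : DegenerateMaximum.UnitSphere d), (t, r, θ, q, η) ∈ χ.source →
        ∃ χ₁ χ₂ : ℝ, χ (t, r, θ, q, η) = (t, χ₁, χ₂, θ, η) ∧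
          -- `χ₂` has the sign of `r`, and on `r = 0` the coordinate `χ₁` has the sign of `q`
          SignType.sign χ₂ = SignType.sign r ∧
          (r = 0 → SignType.sign χ₁ = SignType.sign q) ∧
          -- the normal form of the phase
          DegenerateMaximum.phase S Ec t (x₀ + r • (θ : DegenerateMaximum.Conf d))
              (q • (η : DegenerateMaximum.Conf d)) =
            -t * (χ₁ ^ 2 - χ₂ ^ (2 * k)) := by
  have hk := hmax.two_le
  obtain ⟨Ψ, τ, ρ, hτ, hΨ, hΨS⟩ := hS.exists_solvesCentered x₀ Ec hT hW
  obtain ⟨α, β, γ, hα, hβ, hγ, hform, hzero⟩ :=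
    hΨ.exists_quadratic_form (hmax.hasLeadingPart hV)
  set O : Set (ℝ × ℝ × DegenerateMaximum.Conf d × ℝ × DegenerateMaximum.Conf d) :=
    {u | |u.1| < τ ∧ ‖u.2.1 • u.2.2.1‖ < ρ ∧ ‖u.2.2.2.1 • u.2.2.2.2‖ < ρ}
  have hO : IsOpen O :=
    (isOpen_lt (f := fun u : ℝ × ℝ × DegenerateMaximum.Conf d × ℝ × DegenerateMaximum.Conf d => |u.1|) (by fun_prop)
      continuous_const).inter
      ((isOpen_lt (f := fun u : ℝ × ℝ × DegenerateMaximum.Conf d × ℝ × DegenerateMaximum.Conf d => ‖u.2.1 • u.2.2.1‖) (by fun_prop)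
        continuous_const).inter
        (isOpen_lt (f := fun u : ℝ × ℝ × DegenerateMaximum.Conf d × ℝ × DegenerateMaximum.Conf d => ‖u.2.2.2.1 • u.2.2.2.2‖)
          (by fun_prop) continuous_const))
  obtain ⟨e, he, hes, hKe, heO, hnf⟩ := DegenerateMaximum.exists_square_coordinates hα hβ hγ (k := k) (by omega)
    (T := T) hO (fun t ht θ η hθ hη => by
      have hts : |t| < τ := (abs_le.2 ht).trans_lt hτ
      refine ⟨⟨hts, by simpa using hΨ.radius_pos, by simpa using hΨ.radius_pos⟩, ?_, ?_⟩
      -- On the exceptional set γ = ‖η‖² = 1 and α = -`V2k` θ; negative definiteness of `V2k` enters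
      -- only here.
      · rw [(hzero t hts θ η).1, hη]; norm_num
      · rw [(hzero t hts θ η).2]
        have : θ ≠ 0 := fun h => by simp [h] at hθ
        linarith [hmax.negative θ this])
  obtain ⟨χ, hχ, hχs, hsource, hval⟩ := DegenerateMaximum.exists_sphere_restriction e he hes (by
    rintro ⟨t, r, θ, q, η⟩ hu
    obtain ⟨χ₁, χ₂, h, -⟩ := hnf t r q θ η hu
    rw [h]
    exact ⟨rfl, rfl, rfl⟩)
  refine ⟨χ, hχ, hχs, fun t ht θ η => ?_, fun u hu => ?_, fun t r q θ η hu => ?_⟩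
  · rw [hsource]
    exact hKe t ht θ η (by simp) (by simp)
  · rw [hsource] at hu
    obtain ⟨h1, h2, h3⟩ := heO hu
    exact (hΨS _ _ _ h1 h2 h3).1
  · rw [hsource] at hu
    obtain ⟨h1, h2, h3⟩ := heO hu
    obtain ⟨χ₁, χ₂, h, hs₂, hs₁, hnf⟩ := hnf t r q θ η hu
    refine ⟨χ₁, χ₂, ?_, hs₂, hs₁, ?_⟩
    · rw [hval]
      simp only [DegenerateMaximum.blowUpIncl, h]
    · rw [(hΨS t (r • (θ : DegenerateMaximum.Conf d)) (q • (η : DegenerateMaximum.Conf d)) h1 h2 h3).2, ← hnf]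
      exact hform t h1 r q θ η
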